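/- Let $d\ge 5$, let $\{S_k,\,k\ge 0\}$ be the nearest-neighbour symmetric (simple) random walk on $\mathbb{Z}^d$ with $S_0=0$, let $\mathbb{P}_0$ be its law, and let $l_n(x)=\sum_{k=0}^n \mathbf{1}\{S_k=x\}$ be the number of visits to $x\in\mathbb{Z}^d$ up to time $n$. Let $p,\gamma$ be real numbers and write $a^+=\max(a,0)$. (i) Assume $p>\frac{d}{d-2}$ and $p>\gamma>1+\frac{(p-2)^+}{(d-2)p+4}$. Then there are constants $c_1,c_2>0$ such that, for all sufficiently large $n$, $$e^{-c_1 n^{\gamma/p}}\le \mathbb{P}_0\Big(\sum_{x\in\mathbb{Z}^d} l_n(x)^p>n^\gamma\Big)\le e^{-c_2 n^{\gamma/p}}.$$ (ii) Assume $1<p\le\frac{d}{d-2}$ and $p>\gamma>1$, and set $\zeta=1-\frac{2}{d}\,\frac{p-\gamma}{p-1}$. Then for every $\epsilon>0$ there are constants $d_1,d_2>0$ such that, for all sufficiently large $n$, $$e^{-d_1 n^{\zeta}}\le \mathbb{P}_0\Big(\sum_{x\in\mathbb{Z}^d} l_n(x)^p>n^\gamma\Big)\le e^{-d_2 n^{\zeta-\epsilon}}.$$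 -/

import Mathlib

open MeasureTheory ProbabilityTheory

/-- `S` is, under `μ`, the nearest-neighbour symmetric (simple) random walk on `ℤ^d` started at the
origin: the increments are independent, and each is uniform on the `2d` unit vectors `± e_i`. -/
structure IsSimpleRandomWalk {Ω : Type*} [MeasurableSpace Ω] (μ : Measure Ω) (d : ℕ)
    (S : ℕ → Ω → (Fin d → ℤ)) : Prop where
  measurable : ∀ k, Measurable (S k)
  start : ∀ᵐ ω ∂μ, S 0 ω = 0
  indep : iIndepFun (fun k ω => S (k + 1) ω - S k ω) μ
  step : ∀ (k : ℕ) (i : Fin d) (s : ℤˣ),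
    μ.real {ω | S (k + 1) ω - S k ω = Pi.single i (s : ℤ)} = 1 / (2 * (d : ℝ))

/-- The local time `l_n(x) = ∑_{k=0}^n 1{s_k = x}` of a path `s`. -/
def localTime {d : ℕ} (s : ℕ → (Fin d → ℤ)) (n : ℕ) (x : Fin d → ℤ) : ℕ :=
  ∑ k ∈ Finset.range (n + 1), if s k = x then 1 else 0

/-- `∑_{x ∈ ℤ^d} l_n(x)^p`; for `p > 0` only the finitely many visited sites contribute. -/
noncomputable def localTimePowerSum {d : ℕ} (s : ℕ → (Fin d → ℤ)) (n : ℕ) (p : ℝ) : ℝ :=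
  ∑' x : Fin d → ℤ, (localTime s n x : ℝ) ^ p

/-! The upper bounds rest on one estimate for level sets: for each `b < 1 - 2/d`, the probability
that at least `m` sites are visited at least `t` times by time `n` is at most `exp(-c t m^b)`, as
soon as `t ≥ C log n` (`exists_measureReal_card_levelSet_le`). A Green function would show that the
walk stays a bounded time in a set whose potential is bounded. Here a superharmonic Riesz kernel `g`
takes its place (`exists_superharmonic_kernel`): a set `U` with `∑_{y ∈ U} g(x - y) ≤ K` on `U` has
an occupation time with a uniform exponential moment. A set of `m` sites may have potential of order
`m^(1-b)`. Colouring it with about `m^(1-b)` colours at minimal energy yields a subset of about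
`m^b` sites with bounded potential (`exists_subset_sum_le`). All of these are visited `t` times,
which costs `exp(-c t m^b)`. The union over such subsets of the box of radius `n` is affordable
because `t` is at least logarithmic.

Cutting `∑ l_n(x)^p` into dyadic heights `T = 2^j` then leaves a deterministic question: bound `∑
D_j T^p` when `T D_j^b < W` for all `j`. If `p > 1/b` the highest levels dominate and the sum is of
order `W^p`, so `W ≈ n^(γ/p)` (`sum_levels_le_of_lt`). If `p ≤ 1/b`, interpolation with `D_j T ≤ n +
1` gives the exponent `ζ` up to the loss from `b < 1 - 2/d` (`level_le_of_lt`). Heights below `C log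
n` contribute only `n` times a power of `log n`, negligible against `n^γ`.

The lower bounds come from explicit strategies: oscillating between the origin and a neighbour for
about `2 n^(γ/p)` steps, or staying up to time `n` in a box of volume about `n^((p-γ)/(p-1))`, where
convexity forces a large power sum. -/

/-! ### One-step averages and the Markov property. -/

/-- The mean of `f` over the `2d` neighbours of `x`. -/
noncomputable def stepAvg {d : ℕ} (f : (Fin d → ℤ) → ℝ) (x : Fin d → ℤ) : ℝ :=
  (∑ i : Fin d, (f (x + Pi.single i 1) + f (x - Pi.single i 1))) / (2 * d)

theorem stepAvg_mono {d : ℕ} {f g : (Fin d → ℤ) → ℝ} {x : Fin d → ℤ}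
    (h : ∀ i, f (x + Pi.single i 1) ≤ g (x + Pi.single i 1) ∧
      f (x - Pi.single i 1) ≤ g (x - Pi.single i 1)) : stepAvg f x ≤ stepAvg g x := by
  unfold stepAvg
  gcongr with i
  · exact (h i).1
  · exact (h i).2

theorem stepAvg_eq_sum_units {d : ℕ} (f : (Fin d → ℤ) → ℝ) (x : Fin d → ℤ) :
    stepAvg f x = ∑ q : Fin d × ℤˣ, f (x + Pi.single q.1 (q.2 : ℤ)) * (1 / (2 * d)) := by
  rw [Fintype.sum_prod_type, stepAvg, Finset.sum_div]
  refine Finset.sum_congr rfl fun i _ => ?_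
  rw [show (Finset.univ : Finset ℤˣ) = {1, -1} from rfl, Finset.sum_pair (by decide)]
  simp only [Units.val_one, Units.val_neg, Pi.single_neg, ← sub_eq_add_neg]
  ring

theorem single_units_injective {d : ℕ} :
    Function.Injective (fun q : Fin d × ℤˣ => (Pi.single q.1 (q.2 : ℤ) : Fin d → ℤ)) := by
  rintro ⟨i, s⟩ ⟨j, t⟩ h
  simp only at h
  have hs : (s : ℤ) ≠ 0 := s.ne_zero
  by_cases hij : i = j
  · subst hij
    have := Pi.single_injective (M := fun _ : Fin d => ℤ) i h
    simpa [Units.ext_iff] using this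
  · have := congrFun h i
    rw [Pi.single_eq_same, Pi.single_eq_of_ne hij] at this
    exact absurd this hs

namespace IsSimpleRandomWalk

variable {Ω : Type*} [MeasurableSpace Ω] {μ : Measure Ω} {d : ℕ}
  {S : ℕ → Ω → (Fin d → ℤ)}

theorem ae_eq_sum (hS : IsSimpleRandomWalk μ d S) :
    ∀ᵐ ω ∂μ, ∀ j, S j ω = ∑ i ∈ Finset.range j, (S (i + 1) ω - S i ω) := by
  filter_upwards [hS.start] with ω hω j
  rw [Finset.sum_range_sub (fun i => S i ω), hω, sub_zero]

/-- The functional factors through the first `k + 1` positions, which live in a countable discrete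
space. The path is padded with `0` after time `k`. -/
theorem measurable_of_depends (hS : IsSimpleRandomWalk μ d S) (k : ℕ)
    {Φ : (ℕ → (Fin d → ℤ)) → ℝ} (hΦ : ∀ s s', (∀ j ≤ k, s j = s' j) → Φ s = Φ s') :
    Measurable fun ω => Φ (fun j => S j ω) := by
  have h1 : Measurable fun ω => (fun j : Fin (k + 1) => S j ω) :=
    measurable_pi_lambda _ fun j => hS.measurable j
  have h2 : Measurable fun y : Fin (k + 1) → (Fin d → ℤ) =>
      Φ (fun j => if h : j < k + 1 then y ⟨j, h⟩ else 0) := Measurable.of_discrete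
  convert h2.comp h1 using 1
  funext ω
  refine hΦ _ _ fun j hj => ?_
  simp [Nat.lt_succ_of_le hj]

variable [IsProbabilityMeasure μ]

/-- The `2d` prescribed step events are disjoint and their masses `1/(2d)` already add up to one. -/
theorem ae_step (hS : IsSimpleRandomWalk μ d S) (hd : 0 < d) (k : ℕ) :
    ∀ᵐ ω ∂μ, ∃ q : Fin d × ℤˣ, S (k + 1) ω - S k ω = Pi.single q.1 (q.2 : ℤ) := by
  have hX : Measurable fun ω => S (k + 1) ω - S k ω := (hS.measurable _).sub (hS.measurable _)
  set A : Fin d × ℤˣ → Set Ω := fun q => {ω | S (k + 1) ω - S k ω = Pi.single q.1 (q.2 : ℤ)}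
  have hA : ∀ q, MeasurableSet (A q) := fun q => hX (measurableSet_singleton _)
  have hU : μ.real (⋃ q, A q) = 1 := by
    rw [measureReal_iUnion_fintype]
    · have : ∀ q : Fin d × ℤˣ, μ.real (A q) = 1 / (2 * (d : ℝ)) := fun q => hS.step k q.1 q.2
      simp only [this, Finset.sum_const, Finset.card_univ, Fintype.card_prod, Fintype.card_fin,
        nsmul_eq_mul]
      rw [show Fintype.card ℤˣ = 2 from rfl]
      have : (d : ℝ) ≠ 0 := by positivity
      push_cast
      field_simp
    · intro q r hqr
      refine Set.disjoint_left.2 fun ω h1 h2 => hqr (single_units_injective ?_)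
      exact (Set.mem_ofPred.1 h1).symm.trans h2
    · exact hA
  have hU' : μ (⋃ q, A q) = 1 := by
    rw [measureReal_def] at hU
    rw [← ENNReal.ofReal_toReal (measure_ne_top μ (⋃ q, A q)), hU, ENNReal.ofReal_one]
  have := (mem_ae_iff_prob_eq_one (MeasurableSet.iUnion hA)).2 hU'
  filter_upwards [this] with ω hω
  simpa [A] using hω

theorem integrable_of_depends (hS : IsSimpleRandomWalk μ d S) (k : ℕ)
    {Φ : (ℕ → (Fin d → ℤ)) → ℝ} (hΦ : ∀ s s', (∀ j ≤ k, s j = s' j) → Φ s = Φ s')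
    {C : ℝ} (hC : ∀ s, |Φ s| ≤ C) :
    Integrable (fun ω => Φ (fun j => S j ω)) μ :=
  Integrable.of_bound (hS.measurable_of_depends k hΦ).aestronglyMeasurable C
    (Filter.Eventually.of_forall fun _ => hC _)

/-- The Markov property at time `k`. -/
theorem integral_mul_succ (hS : IsSimpleRandomWalk μ d S) (hd : 0 < d) (k : ℕ)
    {Φ : (ℕ → (Fin d → ℤ)) → ℝ} (hΦ : ∀ s s', (∀ j ≤ k, s j = s' j) → Φ s = Φ s')
    {C : ℝ} (hC : ∀ s, |Φ s| ≤ C) {f : (Fin d → ℤ) → ℝ} {C' : ℝ} (hf : ∀ x, |f x| ≤ C') :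
    ∫ ω, Φ (fun j => S j ω) * f (S (k + 1) ω) ∂μ =
      ∫ ω, Φ (fun j => S j ω) * stepAvg f (S k ω) ∂μ := by
  classical
  set X : ℕ → Ω → (Fin d → ℤ) := fun k ω => S (k + 1) ω - S k ω with hXdef
  have hX : ∀ k, Measurable (X k) := fun k => (hS.measurable _).sub (hS.measurable _)
  set Y : Ω → (Finset.range k → (Fin d → ℤ)) := fun ω i => X i ω with hYdef
  have hY : Measurable Y := measurable_pi_lambda _ fun i => hX i
  -- `r` rebuilds the path from its first `k` increments, so that the past becomes a function of
  -- `Y`, independent of the next step. The default `0` is never read for `j ≤ k`.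
  set r : (Finset.range k → (Fin d → ℤ)) → ℕ → (Fin d → ℤ) :=
    fun y j => ∑ i ∈ Finset.range j, if h : i ∈ Finset.range k then y ⟨i, h⟩ else 0 with hr
  have hind : IndepFun Y (X k) μ := by
    have h := hS.indep.indepFun_finset (Finset.range k) {k} (by simp) hX
    exact h.comp (φ := id) (ψ := fun z : ({k} : Finset ℕ) → (Fin d → ℤ) =>
      z ⟨k, Finset.mem_singleton_self k⟩) measurable_id (measurable_pi_apply _)
  have hrec : ∀ᵐ ω ∂μ, ∀ j ≤ k, S j ω = r (Y ω) j := by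
    filter_upwards [hS.ae_eq_sum] with ω hω j hj
    rw [hω j]
    refine Finset.sum_congr rfl fun i hi => ?_
    have : i < k := (Finset.mem_range.1 hi).trans_le hj
    simp [hYdef, hXdef, this]
  set G : Fin d × ℤˣ → (Finset.range k → (Fin d → ℤ)) → ℝ :=
    fun q y => Φ (r y) * f (r y k + Pi.single q.1 (q.2 : ℤ)) with hG
  set I : Fin d × ℤˣ → (Fin d → ℤ) → ℝ :=
    fun q v => if v = Pi.single q.1 (q.2 : ℤ) then 1 else 0 with hI
  have hC0 : 0 ≤ C := (abs_nonneg _).trans (hC 0)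
  have hGb : ∀ q y, ‖G q y‖ ≤ C * C' := fun q y => by
    rw [Real.norm_eq_abs, hG, abs_mul]
    exact mul_le_mul (hC _) (hf _) (abs_nonneg _) hC0
  have hGm : ∀ q, Measurable fun ω => G q (Y ω) := fun q =>
    (Measurable.of_discrete (f := G q)).comp hY
  have hIm : ∀ q, Measurable fun ω => I q (X k ω) := fun q =>
    (Measurable.of_discrete (f := I q)).comp (hX k)
  have hGi : ∀ q, Integrable (fun ω => G q (Y ω)) μ := fun q =>
    Integrable.of_bound (hGm q).aestronglyMeasurable (C * C')
      (Filter.Eventually.of_forall fun ω => hGb _ _)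
  have hIi : ∀ q, Integrable (fun ω => G q (Y ω) * I q (X k ω)) μ := fun q =>
    Integrable.of_bound ((hGm q).mul (hIm q)).aestronglyMeasurable (C * C')
      (Filter.Eventually.of_forall fun ω => by
        rw [norm_mul]
        refine (mul_le_of_le_one_right (norm_nonneg _) ?_).trans (hGb _ _)
        simp only [hI]
        split_ifs <;> simp)
  have hII : ∀ q, ∫ ω, I q (X k ω) ∂μ = 1 / (2 * d) := fun q => by
    rw [← hS.step k q.1 q.2, ← integral_indicator_one]
    · refine integral_congr_ae (Filter.Eventually.of_forall fun ω => ?_)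
      simp only [hI, hXdef, Set.indicator_apply, Set.mem_ofPred_eq, Pi.one_apply]
    · exact hX k (measurableSet_singleton _)
  calc ∫ ω, Φ (fun j => S j ω) * f (S (k + 1) ω) ∂μ
      = ∫ ω, ∑ q, G q (Y ω) * I q (X k ω) ∂μ := by
        refine integral_congr_ae ?_
        filter_upwards [hrec, hS.ae_step hd k] with ω h1 h2
        obtain ⟨q, hq⟩ := h2
        have hXq : X k ω = Pi.single q.1 (q.2 : ℤ) := hq
        rw [Finset.sum_eq_single q]
        · have h3 : S (k + 1) ω = r (Y ω) k + Pi.single q.1 (q.2 : ℤ) := by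
            rw [← h1 k le_rfl, ← hq]; abel
          simp only [hG, hI, hXq, if_true, mul_one]
          rw [h3, hΦ _ (r (Y ω)) h1]
        · intro q' _ hne
          have : X k ω ≠ Pi.single q'.1 (q'.2 : ℤ) := fun h =>
            hne (single_units_injective (h.symm.trans hXq))
          simp [hI, this]
        · simp
    _ = ∑ q, ∫ ω, G q (Y ω) * I q (X k ω) ∂μ := integral_finsetSum _ fun q _ => hIi q
    _ = ∑ q, (∫ ω, G q (Y ω) ∂μ) * (1 / (2 * d)) := by
        refine Finset.sum_congr rfl fun q _ => ?_
        rw [← hII q]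
        exact (hind.comp (Measurable.of_discrete (f := G q))
          (Measurable.of_discrete (f := I q))).integral_fun_mul_eq_mul_integral
          (hGm q).aestronglyMeasurable (hIm q).aestronglyMeasurable
    _ = ∫ ω, ∑ q, G q (Y ω) * (1 / (2 * d)) ∂μ := by
        rw [integral_finsetSum _ fun q _ => (hGi q).mul_const _]
        exact Finset.sum_congr rfl fun q _ => (integral_mul_const _ _).symm
    _ = _ := by
        refine integral_congr_ae ?_
        filter_upwards [hrec] with ω h1
        rw [stepAvg_eq_sum_units, Finset.mul_sum, hΦ _ (r (Y ω)) h1, h1 k le_rfl]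
        exact Finset.sum_congr rfl fun q _ => by simp only [hG]; ring

end IsSimpleRandomWalk

/-! ### A superharmonic kernel on the lattice. -/

/-- The even part of the Taylor expansion has second-order coefficient `α(α+1)`; the strict
inequality leaves room for the remainder near `0`. The proof compares derivatives on `[0, s₀]`, then
uses symmetry. -/
theorem exists_rpow_neg_symm_le {α K : ℝ} (hK : α * (α + 1) < K) :
    ∃ s₀ > 0, s₀ < 1 ∧ ∀ s, |s| ≤ s₀ → (1 + s) ^ (-α) + (1 - s) ^ (-α) ≤ 2 + K * s ^ 2 := by
  have hd1 : ∀ (β s : ℝ), -1 < s → HasDerivAt (fun s : ℝ => (1 + s) ^ (-β)) (-β * (1 + s) ^ (-β - 1)) s := by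
    intro β s hs
    have h := ((hasDerivAt_id s).const_add 1).rpow_const (p := -β) (Or.inl (by simp; linarith))
    simpa using h
  have hd2 : ∀ (β s : ℝ), s < 1 → HasDerivAt (fun s : ℝ => (1 - s) ^ (-β)) (β * (1 - s) ^ (-β - 1)) s := by
    intro β s hs
    have h := ((hasDerivAt_id s).const_sub 1).rpow_const (p := -β) (Or.inl (by simp; linarith))
    simpa using h
  obtain ⟨s₀, hs₀, hs₁, H⟩ : ∃ s₀ > 0, s₀ < 1 ∧ ∀ s, 0 < s → s ≤ s₀ →
      α * ((1 - s) ^ (-(α + 1)) - (1 + s) ^ (-(α + 1))) ≤ 2 * K * s := by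
    have h0 : HasDerivAt (fun s : ℝ => α * ((1 - s) ^ (-(α + 1)) - (1 + s) ^ (-(α + 1))) - 2 * K * s)
        (α * ((α + 1) - (-(α + 1))) - 2 * K) 0 := by
      have := (((hd2 (α + 1) 0 (by norm_num)).sub (hd1 (α + 1) 0 (by norm_num))).const_mul α).sub
        ((hasDerivAt_id (0 : ℝ)).const_mul (2 * K))
      exact this.congr_deriv (by simp)
    have hneg : α * ((α + 1) - (-(α + 1))) - 2 * K < 0 := by nlinarith
    have hev := (hasDerivAt_iff_tendsto_slope_zero.1 h0).eventually_lt_const hneg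
    rw [eventually_nhdsWithin_iff, Metric.eventually_nhds_iff] at hev
    obtain ⟨ε, hε, hev⟩ := hev
    refine ⟨min (ε / 2) (1 / 2), by positivity, (min_le_right _ _).trans_lt (by norm_num), ?_⟩
    intro s hs hs'
    have hlt : dist s 0 < ε := by
      rw [Real.dist_eq, sub_zero, abs_of_pos hs]
      linarith [hs'.trans (min_le_left (ε / 2) (1 / 2))]
    have := hev hlt hs.ne'
    simp only [zero_add, sub_zero, smul_eq_mul, add_zero, Real.one_rpow, sub_self, mul_zero] at this
    by_contra! hcon
    exact absurd this (not_lt.2 (mul_nonneg (inv_pos.2 hs).le (by linarith)))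
  refine ⟨s₀, hs₀, hs₁, ?_⟩
  have key : ∀ s, 0 ≤ s → s ≤ s₀ → (1 + s) ^ (-α) + (1 - s) ^ (-α) ≤ 2 + K * s ^ 2 := by
    intro s hs hs'
    set F : ℝ → ℝ := fun s => 2 + K * s ^ 2 - ((1 + s) ^ (-α) + (1 - s) ^ (-α)) with hF
    have hFd : ∀ x, 0 ≤ x → x ≤ s₀ → HasDerivAt F (K * (2 * x) -
        (-α * (1 + x) ^ (-α - 1) + α * (1 - x) ^ (-α - 1))) x := by
      intro x h0 h1
      have := (((hasDerivAt_pow 2 x).const_mul K).const_add 2).sub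
        ((hd1 α x (by linarith)).add (hd2 α x (by linarith)))
      exact this.congr_deriv (by simp)
    have hmono : MonotoneOn F (Set.Icc 0 s₀) := by
      refine monotoneOn_of_deriv_nonneg (convex_Icc _ _)
        (fun x hx => (hFd x hx.1 hx.2).continuousAt.continuousWithinAt) ?_ ?_
      · intro x hx
        rw [interior_Icc] at hx
        exact (hFd x hx.1.le hx.2.le).differentiableAt.differentiableWithinAt
      · intro x hx
        rw [interior_Icc] at hx
        rw [(hFd x hx.1.le hx.2.le).deriv]
        have := H x hx.1 hx.2.le
        rw [neg_add'] at this
        linarith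
    have := hmono ⟨le_rfl, hs₀.le⟩ ⟨hs, hs'⟩ hs
    simp only [hF] at this
    norm_num at this
    linarith
  intro s hs
  rcases le_total 0 s with h | h
  · exact key s h ((le_abs_self s).trans hs)
  · have := key (-s) (by linarith) ((neg_le_abs s).trans hs)
    rw [neg_sq, ← sub_eq_add_neg, sub_neg_eq_add] at this
    linarith

/-- The regularised Riesz kernel on `ℤ^d`. -/
noncomputable def rieszKernel {d : ℕ} (a α : ℝ) (x : Fin d → ℤ) : ℝ :=
  (a + ∑ i, (x i : ℝ) ^ 2) ^ (-α)

theorem rieszKernel_neg {d : ℕ} (a α : ℝ) (x : Fin d → ℤ) :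
    rieszKernel a α (-x) = rieszKernel a α x := by simp [rieszKernel]

theorem rieszKernel_pos {d : ℕ} {a : ℝ} (α : ℝ) (ha : 1 ≤ a) (x : Fin d → ℤ) :
    0 < rieszKernel a α x := by
  have : 0 ≤ ∑ i, (x i : ℝ) ^ 2 := Finset.sum_nonneg fun i _ => sq_nonneg _
  exact Real.rpow_pos_of_pos (by linarith) _

theorem rieszKernel_le_one {d : ℕ} {a α : ℝ} (hα : 0 ≤ α) (ha : 1 ≤ a) (x : Fin d → ℤ) :
    rieszKernel a α x ≤ 1 := by
  have : 0 ≤ ∑ i, (x i : ℝ) ^ 2 := Finset.sum_nonneg fun i _ => sq_nonneg _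
  exact Real.rpow_le_one_of_one_le_of_nonpos (by linarith) (by linarith)

theorem sum_sq_add_single {d : ℕ} (x : Fin d → ℤ) (i : Fin d) (s : ℤ) :
    ∑ j, (((x + Pi.single i s : Fin d → ℤ) j : ℤ) : ℝ) ^ 2 =
      ∑ j, (x j : ℝ) ^ 2 + 2 * s * x i + (s : ℝ) ^ 2 := by
  have : ∀ j, (((x + Pi.single i s : Fin d → ℤ) j : ℤ) : ℝ) ^ 2 =
      (x j : ℝ) ^ 2 + if j = i then 2 * s * (x i : ℝ) + (s : ℝ) ^ 2 else 0 := by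
    intro j
    by_cases h : j = i
    · subst h; simp; ring
    · simp [h]
  simp only [this, Finset.sum_add_distrib, Finset.sum_ite_eq', Finset.mem_univ, if_true]
  ring

theorem stepAvg_rieszKernel_zero {d : ℕ} (hd : 0 < d) (a α : ℝ) :
    stepAvg (rieszKernel a α) (0 : Fin d → ℤ) = (a + 1) ^ (-α) := by
  have h1 : ∀ i : Fin d, rieszKernel a α (0 + Pi.single i 1 : Fin d → ℤ) = (a + 1) ^ (-α) := by
    intro i
    rw [rieszKernel, sum_sq_add_single]; simp
  have h2 : ∀ i : Fin d, rieszKernel a α (0 - Pi.single i 1 : Fin d → ℤ) = (a + 1) ^ (-α) := by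
    intro i
    rw [← h1 i, ← rieszKernel_neg]; congr 1; abel
  have : (d : ℝ) ≠ 0 := by positivity
  simp only [stepAvg, h1, h2, Finset.sum_const, Finset.card_univ, Fintype.card_fin, nsmul_eq_mul]
  field_simp
  ring

/-- The Riesz kernel of exponent below `(d - 2) / 2` is superharmonic once regularised enough. -/
theorem exists_stepAvg_rieszKernel_le {d : ℕ} {α : ℝ} (hα : 0 < α) (hd : α + 1 < (d : ℝ) / 2) :
    ∃ a : ℝ, 1 ≤ a ∧ ∀ x : Fin d → ℤ, stepAvg (rieszKernel a α) x ≤ rieszKernel a α x := by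
  -- This is where `α + 1 < d/2` enters. Averaged over the `d` directions, `K = α d/2` will produce
  -- exactly the factor `1 + α/v`.
  obtain ⟨s₀, hs₀, hs₁, H⟩ := exists_rpow_neg_symm_le (K := α * (d / 2))
    (by gcongr)
  refine ⟨max 1 (4 / s₀ ^ 2), le_max_left _ _, fun x => ?_⟩
  set a := max 1 (4 / s₀ ^ 2)
  have ha1 : 1 ≤ a := le_max_left _ _
  have ha2 : 4 / s₀ ^ 2 ≤ a := le_max_right _ _
  set q : ℝ := ∑ j, (x j : ℝ) ^ 2 with hq
  have hq0 : 0 ≤ q := Finset.sum_nonneg fun i _ => sq_nonneg _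
  -- The regularised squared norms of the neighbours are `v ± 2 x i`, and that of `x` itself is `v -
  -- 1`. The choice `a ≥ 4 / s₀²` keeps `2 x i / v` within `s₀`.
  set v : ℝ := a + q + 1 with hv
  have hv1 : 1 < v := by linarith
  have hv0 : 0 < v := by linarith
  have hd0 : (0 : ℝ) < d := by linarith
  have hs4 : 4 ≤ s₀ ^ 2 * v := by
    rw [div_le_iff₀ (by positivity)] at ha2
    nlinarith [sq_nonneg s₀]
  have hterm : ∀ i, rieszKernel a α (x + Pi.single i 1) + rieszKernel a α (x - Pi.single i 1) ≤
      v ^ (-α) * (2 + α * (d / 2) * (2 * x i / v) ^ 2) := by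
    intro i
    have hxi : (x i : ℝ) ^ 2 ≤ q :=
      Finset.single_le_sum (f := fun j => (x j : ℝ) ^ 2) (fun j _ => sq_nonneg _) (Finset.mem_univ i)
    have hs : |2 * x i / v| ≤ s₀ := by
      refine abs_le_of_sq_le_sq ?_ hs₀.le
      rw [div_pow, div_le_iff₀ (by positivity)]
      nlinarith
    have hs' := abs_le.1 hs
    have e1 : rieszKernel a α (x + Pi.single i 1) = v ^ (-α) * (1 + 2 * x i / v) ^ (-α) := by
      rw [← Real.mul_rpow hv0.le (by linarith), rieszKernel, sum_sq_add_single]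
      congr 1
      field_simp
      push_cast
      ring
    have e2 : rieszKernel a α (x - Pi.single i 1) = v ^ (-α) * (1 - 2 * x i / v) ^ (-α) := by
      rw [← Real.mul_rpow hv0.le (by linarith), rieszKernel, sub_eq_add_neg, ← Pi.single_neg,
        sum_sq_add_single]
      congr 1
      field_simp
      push_cast
      ring
    rw [e1, e2, ← mul_add]
    exact mul_le_mul_of_nonneg_left (H _ hs) (by positivity)
  have hsum : stepAvg (rieszKernel a α) x ≤ v ^ (-α) * (1 + α / v) := by
    rw [stepAvg, div_le_iff₀ (by positivity)]
    refine (Finset.sum_le_sum fun i _ => hterm i).trans ?_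
    rw [← Finset.mul_sum, mul_assoc]
    refine mul_le_mul_of_nonneg_left ?_ (by positivity)
    have e : ∀ i, 2 + α * (d / 2) * (2 * x i / v) ^ 2 = 2 + 2 * α * d / v ^ 2 * (x i : ℝ) ^ 2 := by
      intro i
      field_simp
    simp only [e]
    rw [Finset.sum_add_distrib, ← Finset.mul_sum, ← hq]
    simp only [Finset.sum_const, Finset.card_univ, Fintype.card_fin, nsmul_eq_mul]
    have : 2 * α * d / v ^ 2 * q ≤ 2 * α * d / v ^ 2 * v := by
      gcongr
      linarith
    have h3 : 2 * α * d / v ^ 2 * v = α / v * (2 * d) := by field_simp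
    linarith
  refine hsum.trans ?_
  have e : rieszKernel a α x = v ^ (-α) * (1 - 1 / v) ^ (-α) := by
    have : 0 ≤ 1 - 1 / v := by
      rw [sub_nonneg, div_le_one hv0]; exact hv1.le
    rw [← Real.mul_rpow hv0.le this, rieszKernel]
    congr 1
    field_simp
    simp [hv, ← hq]
  rw [e]
  gcongr
  have h1 : 0 < 1 - 1 / v := by
    rw [sub_pos, div_lt_one hv0]; exact hv1
  rw [Real.rpow_def_of_pos h1]
  have h2 : Real.log (1 - 1 / v) ≤ -(1 / v) := by
    linarith [Real.log_le_sub_one_of_pos h1]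
  calc 1 + α / v = α / v + 1 := add_comm _ _
    _ ≤ Real.exp (α / v) := Real.add_one_le_exp _
    _ ≤ _ := Real.exp_le_exp.2 (by
      have := mul_le_mul_of_nonneg_right h2 hα.le
      have e3 : α / v = 1 / v * α := by ring
      linarith)

/-- Splitting the exponent `αq` equally over the coordinates and using `a + |x|² ≥ 1 + x_i²`
dominates the sum by the `d`-th power of a convergent sum over `ℤ`. -/
theorem exists_sum_rieszKernel_rpow_le {d : ℕ} (hd : 0 < d) {a α q : ℝ} (ha : 1 ≤ a)
    (hα : 0 < α) (hq : 0 < q) (hαq : (d : ℝ) < 2 * α * q) :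
    ∃ C > 0, ∀ Λ : Finset (Fin d → ℤ), ∑ x ∈ Λ, rieszKernel a α x ^ q ≤ C := by
  set β : ℝ := α * q / d
  have hd0 : (0 : ℝ) < d := by positivity
  have hβ : 1 < 2 * β := by
    have : 2 * β = 2 * α * q / d := by ring
    rw [this, one_lt_div hd0]; exact hαq
  set w : ℤ → ℝ := fun z => (1 + (z : ℝ) ^ 2) ^ (-β) with hw
  have hw0 : ∀ z, 0 < w z := fun z => Real.rpow_pos_of_pos (by positivity) _
  have hws : Summable w := by
    have h := Real.summable_abs_int_rpow hβ
    refine Summable.of_norm_bounded_eventually h ?_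
    have : ∀ᶠ z : ℤ in Filter.cofinite, z ≠ 0 := (Set.finite_singleton (0 : ℤ)).compl_mem_cofinite
    filter_upwards [this] with z hz
    rw [Real.norm_of_nonneg (hw0 z).le]
    have hz0 : 0 < |(z : ℝ)| := by positivity
    have : |(z : ℝ)| ^ (-(2 * β)) = ((z : ℝ) ^ 2) ^ (-β) := by
      rw [← sq_abs, ← Real.rpow_natCast, ← Real.rpow_mul (abs_nonneg _)]
      congr 1
      push_cast
      ring
    rw [this]
    exact Real.rpow_le_rpow_of_nonpos (by positivity) (by linarith) (by linarith)
  have hpos : 0 < ∑' z, w z := hws.tsum_pos (fun z => (hw0 z).le) 0 (hw0 0)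
  refine ⟨(∑' z, w z) ^ d, by positivity, fun Λ => ?_⟩
  have hle : ∀ x : Fin d → ℤ, rieszKernel a α x ^ q ≤ ∏ i, w (x i) := by
    intro x
    have h0 : 0 ≤ ∑ j, (x j : ℝ) ^ 2 := Finset.sum_nonneg fun i _ => sq_nonneg _
    have hbase : 0 < a + ∑ j, (x j : ℝ) ^ 2 := by linarith
    have e : rieszKernel a α x ^ q = ∏ _i : Fin d, (a + ∑ j, (x j : ℝ) ^ 2) ^ (-β) := by
      rw [Finset.prod_const, Finset.card_univ, Fintype.card_fin, ← Real.rpow_natCast,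
        ← Real.rpow_mul hbase.le, rieszKernel, ← Real.rpow_mul hbase.le]
      congr 1
      simp only [β]
      field_simp
    rw [e]
    refine Finset.prod_le_prod (fun i _ => by positivity) fun i _ => ?_
    refine Real.rpow_le_rpow_of_nonpos (by positivity) ?_ (by linarith)
    have := Finset.single_le_sum (f := fun j => (x j : ℝ) ^ 2) (fun j _ => sq_nonneg _)
      (Finset.mem_univ i)
    exact add_le_add ha this
  set T : Finset ℤ := Λ.biUnion fun x => Finset.univ.image x
  have hsub : Λ ⊆ Fintype.piFinset fun _ : Fin d => T := by
    intro x hx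
    rw [Fintype.mem_piFinset]
    exact fun i => Finset.mem_biUnion.2 ⟨x, hx, Finset.mem_image_of_mem _ (Finset.mem_univ i)⟩
  calc ∑ x ∈ Λ, rieszKernel a α x ^ q ≤ ∑ x ∈ Λ, ∏ i, w (x i) := Finset.sum_le_sum fun x _ => hle x
    _ ≤ ∑ x ∈ Fintype.piFinset fun _ : Fin d => T, ∏ i, w (x i) :=
      Finset.sum_le_sum_of_subset_of_nonneg hsub fun x _ _ =>
        Finset.prod_nonneg fun i _ => (hw0 _).le
    _ = ∏ _i : Fin d, ∑ z ∈ T, w z := (Finset.prod_univ_sum (fun _ => T) fun _ z => w z).symm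
    _ = (∑ z ∈ T, w z) ^ d := by simp
    _ ≤ _ := pow_le_pow_left₀ (Finset.sum_nonneg fun z _ => (hw0 z).le)
      (hws.sum_le_tsum T fun z _ => (hw0 z).le) d

/-- A substitute for the Green function of the walk. -/
theorem exists_superharmonic_kernel {d : ℕ} (hd : 0 < d) {b : ℝ} (hb : 0 < b) (hbd : b < 1 - 2 / (d : ℝ)) :
    ∃ g : (Fin d → ℤ) → ℝ, ∃ c > 0, ∃ C > 0, (∀ x, 0 < g x) ∧ (∀ x, g x ≤ 1) ∧
      (∀ x, g (-x) = g x) ∧ (∀ x, stepAvg g x ≤ g x) ∧ stepAvg g 0 ≤ g 0 - c ∧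
      ∀ (Λ : Finset (Fin d → ℤ)) (x : Fin d → ℤ),
        ∑ y ∈ Λ, g (x - y) ≤ C * (Λ.card : ℝ) ^ (1 - b) := by
  have hd0 : (0 : ℝ) < d := by positivity
  have hb1 : b < 1 := hbd.trans (by linarith [show 0 < 2 / (d : ℝ) by positivity])
  have hbd' : d * b / 2 < d / 2 - 1 := by
    have := mul_lt_mul_of_pos_left hbd hd0
    rw [mul_sub, mul_div_cancel₀ _ hd0.ne'] at this
    linarith
  -- The upper bound on `α` gives superharmonicity; the lower one makes the `1/b`-th power of the
  -- kernel summable. The potential bound then follows by Hölder with exponents `1/b` and `1/(1-b)`.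
  obtain ⟨α, hα1, hα2⟩ := exists_between hbd'
  have hα : 0 < α := lt_trans (by positivity) hα1
  obtain ⟨a, ha, hsup⟩ := exists_stepAvg_rieszKernel_le (d := d) hα (by linarith)
  obtain ⟨C, hC, hsum⟩ := exists_sum_rieszKernel_rpow_le hd (a := a) (α := α) (q := 1 / b) ha hα
    (by positivity) (by rw [mul_one_div, lt_div_iff₀ hb]; linarith)
  refine ⟨rieszKernel a α, a ^ (-α) - (a + 1) ^ (-α), ?_, C ^ b, by positivity,
    rieszKernel_pos α ha, rieszKernel_le_one hα.le ha, rieszKernel_neg a α, hsup, ?_, ?_⟩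
  · rw [gt_iff_lt, sub_pos]
    exact Real.rpow_lt_rpow_of_neg (by linarith) (by linarith) (by linarith)
  · rw [stepAvg_rieszKernel_zero hd]
    simp [rieszKernel]
  · intro Λ x
    have hconj : (1 / b).HolderConjugate (1 / (1 - b)) := by
      rw [Real.holderConjugate_iff]
      refine ⟨by rw [lt_div_iff₀ hb]; linarith, by simp⟩
    have h := Real.inner_le_Lp_mul_Lq_of_nonneg Λ (f := fun y => rieszKernel a α (x - y))
      (g := fun _ => 1) hconj (fun y _ => (rieszKernel_pos α ha _).le) (fun _ _ => zero_le_one)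
    simp only [mul_one, Real.one_rpow, one_div_one_div, Finset.sum_const, nsmul_eq_mul] at h
    refine h.trans ?_
    have h1 : ∑ y ∈ Λ, rieszKernel a α (x - y) ^ (1 / b) ≤ C := by
      rw [← Finset.sum_image (f := fun z => rieszKernel a α z ^ (1 / b)) (g := fun y => x - y)
        (fun y _ z _ h => sub_right_injective h)]
      exact hsum _
    gcongr
    exact Finset.sum_nonneg fun y _ => Real.rpow_nonneg (rieszKernel_pos α ha _).le _

/-! ### Extracting subsets of small potential. -/

/-- A colouring whose monochromatic energy is minimal has classes of small inner degree. -/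
theorem exists_coloring_sum_le {ι : Type*} [Fintype ι] [DecidableEq ι] (g : ι → ι → ℝ)
    (hsymm : ∀ x y, g x y = g y x) (hpos : ∀ x y, 0 ≤ g x y) {N : ℕ} (hN : 0 < N) :
    ∃ φ : ι → Fin N, ∀ x, ∑ y with φ y = φ x, g x y ≤ g x x + (∑ y, g x y) / N := by
  have : Nonempty (Fin N) := ⟨⟨0, hN⟩⟩
  set e : (ι → Fin N) → ι → ι → ℝ := fun φ u v => if φ u = φ v then g u v else 0 with he
  obtain ⟨φ, hφ⟩ := Finite.exists_min fun φ : ι → Fin N => ∑ u, ∑ v, e φ u v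
  refine ⟨φ, fun x => ?_⟩
  have hdec : ∀ ψ : ι → Fin N, ∑ u, ∑ v, e ψ u v = g x x + 2 * ∑ v ∈ Finset.univ.erase x, e ψ x v +
      ∑ u ∈ Finset.univ.erase x, ∑ v ∈ Finset.univ.erase x, e ψ u v := by
    intro ψ
    have h1 : ∀ F : ι → ℝ, ∑ u, F u = F x + ∑ u ∈ Finset.univ.erase x, F u := fun F =>
      (Finset.add_sum_erase _ _ (Finset.mem_univ x)).symm
    rw [h1 fun u => ∑ v, e ψ u v]
    simp only [h1 (e ψ _), Finset.sum_add_distrib]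
    have h2 : ∑ u ∈ Finset.univ.erase x, e ψ u x = ∑ v ∈ Finset.univ.erase x, e ψ x v :=
      Finset.sum_congr rfl fun u _ => by simp only [he, eq_comm (a := ψ u), hsymm u x]
    rw [h2]
    simp only [he, if_true]
    ring
  -- Recolouring the single point `x` with `c` cannot lower the minimal energy. Summing over all `N`
  -- colours then bounds the degree of `x` in its class by an average.
  have hmin : ∀ c : Fin N, ∑ v ∈ Finset.univ.erase x, e φ x v ≤
      ∑ v ∈ Finset.univ.erase x, if φ v = c then g x v else 0 := by
    intro c
    have h := hφ (Function.update φ x c)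
    rw [hdec, hdec] at h
    have h1 : ∑ u ∈ Finset.univ.erase x, ∑ v ∈ Finset.univ.erase x, e (Function.update φ x c) u v =
        ∑ u ∈ Finset.univ.erase x, ∑ v ∈ Finset.univ.erase x, e φ u v :=
      Finset.sum_congr rfl fun u hu => Finset.sum_congr rfl fun v hv => by
        simp only [he, Function.update_of_ne (Finset.ne_of_mem_erase hu),
          Function.update_of_ne (Finset.ne_of_mem_erase hv)]
    have h2 : ∑ v ∈ Finset.univ.erase x, e (Function.update φ x c) x v =
        ∑ v ∈ Finset.univ.erase x, if φ v = c then g x v else 0 :=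
      Finset.sum_congr rfl fun v hv => by
        simp only [he, Function.update_of_ne (Finset.ne_of_mem_erase hv), Function.update_self,
          eq_comm (a := c)]
    rw [h1, h2] at h
    linarith
  have hsum : (N : ℝ) * ∑ v ∈ Finset.univ.erase x, e φ x v ≤ ∑ y, g x y := by
    calc (N : ℝ) * ∑ v ∈ Finset.univ.erase x, e φ x v
        = ∑ _c : Fin N, ∑ v ∈ Finset.univ.erase x, e φ x v := by
          rw [Finset.sum_const, Finset.card_univ, Fintype.card_fin, nsmul_eq_mul]
      _ ≤ ∑ c : Fin N, ∑ v ∈ Finset.univ.erase x, if φ v = c then g x v else 0 :=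
        Finset.sum_le_sum fun c _ => hmin c
      _ = ∑ v ∈ Finset.univ.erase x, g x v := by
        rw [Finset.sum_comm]
        exact Finset.sum_congr rfl fun v _ => by simp
      _ ≤ _ := Finset.sum_le_sum_of_subset_of_nonneg (Finset.subset_univ _) fun y _ _ => hpos x y
  have hN' : (0 : ℝ) < N := by positivity
  rw [Finset.sum_filter, ← Finset.add_sum_erase _ _ (Finset.mem_univ x), if_pos rfl]
  gcongr
  rw [le_div_iff₀ hN', mul_comm]
  rwa [Finset.sum_congr rfl fun v _ => show (if φ v = φ x then g x v else 0) = e φ x v by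
    simp only [he, eq_comm (a := φ v)]]

/-- A large finite set contains a fairly large subset whose inner degrees are small. -/
theorem exists_subset_sum_le {ι : Type*} [DecidableEq ι] (Λ : Finset ι) (g : ι → ι → ℝ)
    (hsymm : ∀ x y, g x y = g y x) (hpos : ∀ x y, 0 ≤ g x y) {N : ℕ} (hN : 0 < N) :
    ∃ U ⊆ Λ, Λ.card ≤ N * U.card ∧ ∀ x ∈ U, ∑ y ∈ U, g x y ≤ g x x + (∑ y ∈ Λ, g x y) / N := by
  obtain ⟨φ, hφ⟩ := exists_coloring_sum_le (fun x y : Λ => g x y) (fun x y => hsymm x y)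
    (fun x y => hpos x y) hN
  -- Pigeonhole over the colour classes.
  have : ∃ c, Λ.card ≤ N * (Finset.univ.filter fun y => φ y = c).card := by
    by_contra! h
    have h1 := Finset.card_eq_sum_card_fiberwise (f := φ) (s := Finset.univ) (t := Finset.univ)
      (fun _ _ => Finset.mem_coe.2 (Finset.mem_univ _))
    rw [Finset.card_univ, Fintype.card_coe] at h1
    have : Nonempty (Fin N) := ⟨⟨0, hN⟩⟩
    have h2 : ∑ c : Fin N, N * (Finset.univ.filter fun y => φ y = c).card < ∑ _c : Fin N, Λ.card :=
      Finset.sum_lt_sum_of_nonempty Finset.univ_nonempty fun c _ => h c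
    rw [← Finset.mul_sum, ← h1] at h2
    simp at h2
  obtain ⟨c, hc⟩ := this
  refine ⟨(Finset.univ.filter fun y => φ y = c).map (Function.Embedding.subtype _), ?_, ?_, ?_⟩
  · intro x hx
    obtain ⟨y, _, rfl⟩ := Finset.mem_map.1 hx
    exact y.2
  · rwa [Finset.card_map]
  · intro x hx
    obtain ⟨y, hy, rfl⟩ := Finset.mem_map.1 hx
    have hy' : φ y = c := (Finset.mem_filter.1 hy).2
    have := hφ y
    rw [hy'] at this
    rw [Finset.sum_map]
    rw [← Finset.sum_coe_sort Λ]
    exact this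

/-! ### Exponential moments of occupation times. -/

theorem localTime_congr {d : ℕ} {s s' : ℕ → (Fin d → ℤ)} {n : ℕ} (h : ∀ j ≤ n, s j = s' j)
    (x : Fin d → ℤ) : localTime s n x = localTime s' n x :=
  Finset.sum_congr rfl fun k hk => by rw [h k (Nat.lt_succ_iff.1 (Finset.mem_range.1 hk))]

theorem sum_localTime {d : ℕ} (s : ℕ → (Fin d → ℤ)) (n : ℕ) (U : Finset (Fin d → ℤ)) :
    ∑ x ∈ U, localTime s n x = ∑ k ∈ Finset.range (n + 1), if s k ∈ U then 1 else 0 := by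
  simp only [localTime]
  rw [Finset.sum_comm]
  exact Finset.sum_congr rfl fun k _ => by simp

theorem sum_localTime_le {d : ℕ} (s : ℕ → (Fin d → ℤ)) (n : ℕ) (U : Finset (Fin d → ℤ)) :
    ∑ x ∈ U, localTime s n x ≤ n + 1 := by
  rw [sum_localTime]
  refine (Finset.sum_le_sum (g := fun _ => 1) fun k _ => ?_).trans (by simp)
  split_ifs <;> simp

/-- The sites visited at least `t` times up to time `n`. -/
def levelSet {d : ℕ} (s : ℕ → (Fin d → ℤ)) (n t : ℕ) : Finset (Fin d → ℤ) :=
  ((Finset.range (n + 1)).image s).filter fun x => t ≤ localTime s n x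

theorem stepAvg_one_add_sum {d : ℕ} (hd : 0 < d) (g : (Fin d → ℤ) → ℝ) (U : Finset (Fin d → ℤ))
    (x : Fin d → ℤ) :
    stepAvg (fun x => 1 + ∑ y ∈ U, g (x - y)) x = 1 + ∑ y ∈ U, stepAvg g (x - y) := by
  have : (d : ℝ) ≠ 0 := by positivity
  simp only [stepAvg]
  rw [← Finset.sum_div, Finset.sum_comm]
  simp only [Finset.sum_add_distrib, Finset.sum_const, Finset.card_univ, Fintype.card_fin,
    nsmul_eq_mul, add_sub_right_comm, sub_right_comm _ (Pi.single _ _)]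
  field_simp
  ring

namespace IsSimpleRandomWalk

variable {Ω : Type*} [MeasurableSpace Ω] {μ : Measure Ω} [IsProbabilityMeasure μ] {d : ℕ}
  {S : ℕ → Ω → (Fin d → ℤ)}

theorem ae_abs_le (hS : IsSimpleRandomWalk μ d S) (hd : 0 < d) :
    ∀ᵐ ω ∂μ, ∀ k i, |S k ω i| ≤ k := by
  filter_upwards [hS.start, ae_all_iff.2 (hS.ae_step hd)] with ω h0 h1 k
  induction k with
  | zero => intro i; simp [h0]
  | succ k ih =>
    intro i
    obtain ⟨⟨j, s⟩, hq⟩ := h1 k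
    have e : S (k + 1) ω i = S k ω i + (Pi.single j (s : ℤ) : Fin d → ℤ) i := by
      rw [← hq]; simp
    have hs : |(Pi.single j (s : ℤ) : Fin d → ℤ) i| ≤ 1 := by
      by_cases h : i = j
      · subst h
        rw [Pi.single_eq_same]
        rcases Int.units_eq_one_or s with rfl | rfl <;> simp
      · rw [Pi.single_eq_of_ne h]; simp
    rw [e]
    push_cast
    exact (abs_add_le _ _).trans (add_le_add (ih i) hs)

/-- The function `h = 1 + ∑_{y ∈ U} g(· - y)` is superharmonic and loses at least `c` in one step
from a point of `U`, where `h ≤ 1 + K`. Each visit to `U` may therefore be rewarded by the factor `ρ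
= 1 + c/(1+K)` while the expectation of the rewarded process does not increase. -/
theorem integral_pow_sum_localTime_le (hS : IsSimpleRandomWalk μ d S) (hd : 0 < d)
    {g : (Fin d → ℤ) → ℝ} {c K : ℝ} (hc : 0 < c) (hg0 : ∀ x, 0 < g x) (hg1 : ∀ x, g x ≤ 1)
    (hsup : ∀ x, stepAvg g x ≤ g x) (hsup0 : stepAvg g 0 ≤ g 0 - c) {U : Finset (Fin d → ℤ)}
    (hU : ∀ x ∈ U, ∑ y ∈ U, g (x - y) ≤ K) (n : ℕ) :
    ∫ ω, (1 + c / (1 + K)) ^ (∑ x ∈ U, localTime (fun k => S k ω) n x) ∂μ ≤ 1 + U.card := by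
  classical
  set h : (Fin d → ℤ) → ℝ := fun x => 1 + ∑ y ∈ U, g (x - y) with hh
  set ρ : ℝ := 1 + c / (1 + K) with hρ
  have hh1 : ∀ x, 1 ≤ h x := fun x => by
    have := Finset.sum_nonneg fun y (_ : y ∈ U) => (hg0 (x - y)).le
    simp only [hh]; linarith
  have hhU : ∀ x, h x ≤ 1 + U.card := fun x => by
    have := Finset.sum_le_card_nsmul U (fun y => g (x - y)) 1 fun y _ => hg1 _
    simp only [nsmul_eq_mul, mul_one] at this
    simp only [hh]; linarith
  have hPh1 : ∀ x, 1 ≤ stepAvg h x := fun x => by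
    have e : stepAvg (fun _ : Fin d → ℤ => (1 : ℝ)) x = 1 := by
      simpa using stepAvg_one_add_sum hd g ∅ x
    rw [← e]
    exact stepAvg_mono fun i => ⟨hh1 _, hh1 _⟩
  have hPh : ∀ x, stepAvg h x ≤ h x := fun x => by
    rw [hh, stepAvg_one_add_sum hd]
    change _ ≤ 1 + ∑ y ∈ U, g (x - y)
    gcongr
    exact hsup _
  -- Positivity of `K` is only forced when `U` has a point.
  rcases U.eq_empty_or_nonempty with rfl | ⟨z, hz⟩
  · simp
  have hK : 0 < K := (Finset.sum_pos (fun y _ => hg0 _) ⟨z, hz⟩).trans_le (hU z hz)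
  have hρ1 : 1 ≤ ρ := by
    have : 0 < c / (1 + K) := by positivity
    linarith
  have hρ0 : 0 < ρ := by linarith
  have hPhU : ∀ x ∈ U, ρ * stepAvg h x ≤ h x := by
    intro x hx
    have h1 : stepAvg h x ≤ h x - c := by
      rw [hh, stepAvg_one_add_sum hd]
      change _ ≤ 1 + ∑ y ∈ U, g (x - y) - c
      rw [← Finset.add_sum_erase U _ hx, ← Finset.add_sum_erase U
        (fun y => g (x - y)) hx, sub_self]
      have := Finset.sum_le_sum fun y (_ : y ∈ U.erase x) => hsup (x - y)
      linarith
    have h2 : h x ≤ 1 + K := by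
      have := hU x hx
      simp only [hh]; linarith
    have h3 : c / (1 + K) * (h x - c) ≤ c := by
      rw [div_mul_eq_mul_div, div_le_iff₀ (by positivity)]
      nlinarith
    calc ρ * stepAvg h x ≤ ρ * (h x - c) := by gcongr
      _ ≤ h x := by rw [hρ]; linarith
  have hstep : ∀ x, ρ ^ (if x ∈ U then 1 else 0) * stepAvg h x ≤ h x := by
    intro x
    split_ifs with hx
    · simpa using hPhU x hx
    · simpa using hPh x
  set V : ℕ → (ℕ → (Fin d → ℤ)) → ℕ := fun n s => ∑ x ∈ U, localTime s n x with hV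
  have hVs : ∀ n s, V (n + 1) s = V n s + if s (n + 1) ∈ U then 1 else 0 := by
    intro n s
    simp only [hV, sum_localTime]
    rw [Finset.sum_range_succ]
  have hVdep : ∀ n s s', (∀ j ≤ n, s j = s' j) → ρ ^ V n s = ρ ^ V n s' := by
    intro n s s' hss
    simp only [hV, localTime_congr hss]
  have hVb : ∀ n s, |ρ ^ V n s| ≤ ρ ^ (n + 1) := by
    intro n s
    rw [abs_of_pos (by positivity)]
    exact pow_le_pow_right₀ hρ1 (sum_localTime_le _ _ _)
  have hhb : ∀ x, |h x| ≤ 1 + U.card := fun x => by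
    rw [abs_of_pos (by linarith [hh1 x])]; exact hhU x
  have hPhb : ∀ x, |stepAvg h x| ≤ 1 + U.card := fun x => by
    rw [abs_of_pos (by linarith [hPh1 x])]; exact (hPh x).trans (hhU x)
  have hint : ∀ n, Integrable (fun ω => ρ ^ V n (fun k => S k ω) * stepAvg h (S n ω)) μ := fun n =>
    hS.integrable_of_depends n (Φ := fun s => ρ ^ V n s * stepAvg h (s n))
      (fun s s' hss => by simp only [hVdep n s s' hss, hss n le_rfl])
      (C := ρ ^ (n + 1) * (1 + U.card)) fun s => by
        rw [abs_mul]
        exact mul_le_mul (hVb n s) (hPhb _) (abs_nonneg _) (by positivity)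
  have hint' : ∀ n, Integrable (fun ω => ρ ^ V n (fun k => S k ω) * h (S (n + 1) ω)) μ := fun n =>
    hS.integrable_of_depends (n + 1) (Φ := fun s => ρ ^ V n s * h (s (n + 1)))
      (fun s s' hss => by
        simp only [hVdep n s s' fun j hj => hss j (hj.trans n.le_succ), hss (n + 1) le_rfl])
      (C := ρ ^ (n + 1) * (1 + U.card)) fun s => by
        rw [abs_mul]
        exact mul_le_mul (hVb n s) (hhb _) (abs_nonneg _) (by positivity)
  -- With `stepAvg h` rather than `h`, the reward for time `n` itself is already paid for by
  -- `hstep`.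
  have main : ∀ n, ∫ ω, ρ ^ V n (fun k => S k ω) * stepAvg h (S n ω) ∂μ ≤ 1 + U.card := by
    intro n
    induction n with
    | zero =>
      refine (integral_mono (hint 0) (integrable_const (1 + (U.card : ℝ))) fun ω => ?_).trans
        (by simp)
      have : V 0 (fun k => S k ω) = if S 0 ω ∈ U then 1 else 0 := by
        simp only [hV, sum_localTime, zero_add, Finset.sum_range_one]
      simp only [this]
      exact (hstep _).trans (hhU _)
    | succ n ih =>
      refine le_trans ?_ ih
      rw [← hS.integral_mul_succ hd n (Φ := fun s => ρ ^ V n s) (hVdep n) (hVb n) hhb]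
      refine integral_mono (hint (n + 1)) (hint' n) fun ω => ?_
      simp only [hVs, pow_add]
      rw [mul_assoc]
      exact mul_le_mul_of_nonneg_left (hstep _) (by positivity)
  refine le_trans (integral_mono (hS.integrable_of_depends n (hVdep n) (hVb n)) (hint n)
    fun ω => ?_) (main n)
  exact le_mul_of_one_le_right (by positivity) (hPh1 _)

theorem measureReal_le_sum_localTime_le (hS : IsSimpleRandomWalk μ d S) (hd : 0 < d)
    {g : (Fin d → ℤ) → ℝ} {c K : ℝ} (hc : 0 < c) (hK : 0 ≤ K) (hg0 : ∀ x, 0 < g x)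
    (hg1 : ∀ x, g x ≤ 1)
    (hsup : ∀ x, stepAvg g x ≤ g x) (hsup0 : stepAvg g 0 ≤ g 0 - c) {U : Finset (Fin d → ℤ)}
    (hU : ∀ x ∈ U, ∑ y ∈ U, g (x - y) ≤ K) (n r : ℕ) :
    μ.real {ω | r ≤ ∑ x ∈ U, localTime (fun k => S k ω) n x} ≤
      (1 + U.card) * ((1 + c / (1 + K)) ^ r)⁻¹ := by
  set ρ : ℝ := 1 + c / (1 + K) with hρ
  have hρ1 : 1 < ρ := by
    have : 0 < c / (1 + K) := by positivity
    linarith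
  have hρ0 : 0 < ρ := by linarith
  have hint : Integrable (fun ω => ρ ^ (∑ x ∈ U, localTime (fun k => S k ω) n x)) μ :=
    hS.integrable_of_depends n (Φ := fun s => ρ ^ (∑ x ∈ U, localTime s n x))
      (fun s s' hss => by simp only [localTime_congr hss]) (C := ρ ^ (n + 1)) fun s => by
        rw [abs_of_pos (by positivity)]
        exact pow_le_pow_right₀ hρ1.le (sum_localTime_le _ _ _)
  have h1 := mul_meas_ge_le_integral_of_nonneg (μ := μ)
    (Filter.Eventually.of_forall fun ω => by positivity) hint (ρ ^ r)
  have h2 := h1.trans (hS.integral_pow_sum_localTime_le hd hc hg0 hg1 hsup hsup0 hU n)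
  simp only [pow_le_pow_iff_right₀ hρ1] at h2
  rw [← div_eq_mul_inv, le_div_iff₀ (by positivity), mul_comm]
  exact h2

end IsSimpleRandomWalk

/-! ### Dyadic decomposition and the size of level sets. -/

theorem localTime_eq_zero {d : ℕ} {s : ℕ → (Fin d → ℤ)} {n : ℕ} {x : Fin d → ℤ}
    (hx : x ∉ (Finset.range (n + 1)).image s) : localTime s n x = 0 :=
  Finset.sum_eq_zero fun k hk => if_neg fun h => hx (Finset.mem_image.2 ⟨k, hk, h⟩)

theorem localTimePowerSum_eq_sum {d : ℕ} (s : ℕ → (Fin d → ℤ)) (n : ℕ) {p : ℝ} (hp : p ≠ 0)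
    {Λ : Finset (Fin d → ℤ)} (hΛ : ∀ k ≤ n, s k ∈ Λ) :
    localTimePowerSum s n p = ∑ x ∈ Λ, (localTime s n x : ℝ) ^ p := by
  refine tsum_eq_sum fun x hx => ?_
  have : x ∉ (Finset.range (n + 1)).image s := fun h => by
    obtain ⟨k, hk, rfl⟩ := Finset.mem_image.1 h
    exact hx (hΛ k (Nat.lt_succ_iff.1 (Finset.mem_range.1 hk)))
  rw [localTime_eq_zero this, Nat.cast_zero, Real.zero_rpow hp]

theorem card_levelSet_mul_le {d : ℕ} (s : ℕ → (Fin d → ℤ)) (n t : ℕ) :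
    (levelSet s n t).card * t ≤ n + 1 := by
  refine le_trans ?_ (sum_localTime_le s n (levelSet s n t))
  rw [← smul_eq_mul]
  exact Finset.card_nsmul_le_sum _ _ _ fun x hx => (Finset.mem_filter.1 hx).2

/-- A site of local time below `2 ^ j₀` costs at most its local time times `(2 ^ j₀) ^ (p - 1)`, and
local times add up to at most `n + 1`. A higher site is charged to the level `j = Nat.log 2 l`,
where `l ≤ 2 * 2 ^ j`. -/
theorem localTimePowerSum_le {d : ℕ} (s : ℕ → (Fin d → ℤ)) (n : ℕ) {p : ℝ} (hp : 1 < p) (j₀ : ℕ) :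
    localTimePowerSum s n p ≤ ((2 : ℝ) ^ j₀) ^ (p - 1) * (n + 1) +
      ∑ j ∈ Finset.Ico j₀ (Nat.log 2 (n + 1) + 1),
        ((levelSet s n (2 ^ j)).card : ℝ) * (2 * (2 : ℝ) ^ j) ^ p := by
  set Λ := (Finset.range (n + 1)).image s with hΛ
  rw [localTimePowerSum_eq_sum s n (by linarith) (Λ := Λ) fun k hk =>
    Finset.mem_image_of_mem _ (Finset.mem_range.2 (Nat.lt_succ_of_le hk))]
  have hx : ∀ x ∈ Λ, (localTime s n x : ℝ) ^ p ≤ ((2 : ℝ) ^ j₀) ^ (p - 1) * localTime s n x +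
      ∑ j ∈ Finset.Ico j₀ (Nat.log 2 (n + 1) + 1),
        if 2 ^ j ≤ localTime s n x then (2 * (2 : ℝ) ^ j) ^ p else 0 := by
    intro x _
    set l := localTime s n x with hl
    have hln : l ≤ n + 1 := by
      simpa using sum_localTime_le s n {x}
    have hnn : ∀ j ∈ Finset.Ico j₀ (Nat.log 2 (n + 1) + 1),
        (0 : ℝ) ≤ if 2 ^ j ≤ l then (2 * (2 : ℝ) ^ j) ^ p else 0 := by
      intro j _
      split_ifs
      · positivity
      · exact le_rfl
    rcases Nat.eq_zero_or_pos l with h0 | h0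
    · have hl0 : (l : ℝ) = 0 := by rw [h0, Nat.cast_zero]
      rw [hl0, Real.zero_rpow (by linarith), mul_zero, zero_add]
      exact Finset.sum_nonneg hnn
    rcases lt_or_ge l (2 ^ j₀) with h | h
    · have h' : (l : ℝ) ≤ (2 : ℝ) ^ j₀ := by exact_mod_cast h.le
      have hl0 : (0 : ℝ) < l := by exact_mod_cast h0
      calc (l : ℝ) ^ p = (l : ℝ) ^ (p - 1) * l := by
            rw [Real.rpow_sub_one hl0.ne']; field_simp
        _ ≤ ((2 : ℝ) ^ j₀) ^ (p - 1) * l := by gcongr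
        _ ≤ _ := le_add_of_nonneg_right (Finset.sum_nonneg hnn)
    · have hj : Nat.log 2 l ∈ Finset.Ico j₀ (Nat.log 2 (n + 1) + 1) := by
        rw [Finset.mem_Ico]
        exact ⟨(Nat.le_log_iff_pow_le one_lt_two h0.ne').2 h,
          Nat.lt_succ_of_le (Nat.log_mono_right hln)⟩
      have h2 := Finset.single_le_sum hnn hj
      rw [if_pos (Nat.pow_log_le_self 2 h0.ne')] at h2
      have h3 : (l : ℝ) ≤ 2 * (2 : ℝ) ^ Nat.log 2 l := by
        have := (Nat.lt_pow_succ_log_self one_lt_two l).le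
        rw [pow_succ'] at this
        exact_mod_cast this
      calc (l : ℝ) ^ p ≤ (2 * (2 : ℝ) ^ Nat.log 2 l) ^ p := by gcongr
        _ ≤ _ := h2
        _ ≤ _ := le_add_of_nonneg_left (by positivity)
  refine (Finset.sum_le_sum hx).trans ?_
  rw [Finset.sum_add_distrib, ← Finset.mul_sum, Finset.sum_comm]
  refine add_le_add ?_ (Finset.sum_le_sum fun j _ => ?_)
  · gcongr
    exact_mod_cast sum_localTime_le s n Λ
  · rw [← Finset.sum_filter, Finset.sum_const, nsmul_eq_mul]
    exact le_rfl

namespace IsSimpleRandomWalk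

/-- Level sets of the local time above a logarithmic height. -/
theorem exists_measureReal_card_levelSet_le {d : ℕ} (hd : 0 < d) {b : ℝ} (hb : 0 < b)
    (hbd : b < 1 - 2 / (d : ℝ)) :
    ∃ c > (0 : ℝ), ∃ C > (0 : ℝ), ∀ (Ω : Type*) [MeasurableSpace Ω] (μ : Measure Ω)
      [IsProbabilityMeasure μ] (S : ℕ → Ω → (Fin d → ℤ)), IsSimpleRandomWalk μ d S →
      ∀ n t m : ℕ, C * Real.log (n + 2) ≤ t → 1 ≤ m →
        μ.real {ω | m ≤ (levelSet (fun k => S k ω) n t).card} ≤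
          Real.exp (-c * (t * (m : ℝ) ^ b)) := by
  classical
  obtain ⟨g, c₀, hc₀, C₀, hC₀, hg0, hg1, hgs, hsup, hsup0, hΛ⟩ := exists_superharmonic_kernel hd hb hbd
  set K : ℝ := 1 + C₀ with hK
  set ρ : ℝ := 1 + c₀ / (1 + K) with hρ
  have hρ1 : 1 < ρ := by
    have : 0 < c₀ / (1 + K) := by positivity
    linarith
  have hρ0 : 0 < ρ := by linarith
  have hlρ : 0 < Real.log ρ := Real.log_pos hρ1
  have hb1 : b < 1 := hbd.trans_le (by
    have : 0 ≤ 2 / (d : ℝ) := by positivity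
    linarith)
  -- Half of the rate `log ρ` pays for the union bound, which fixes the constant in front of `log (n
  -- + 2)`. Another factor two is lost in `u ≥ m ^ b / 2`.
  refine ⟨Real.log ρ / 4, by positivity, 2 * (2 * d + 1) / Real.log ρ, by positivity, ?_⟩
  intro Ω _ μ _ S hS n t m ht hm
  set Q : Finset (Fin d → ℤ) := Fintype.piFinset fun _ => Finset.Icc (-(n : ℤ)) n with hQ
  have hQc : Q.card = (2 * n + 1) ^ d := by
    rw [hQ, Fintype.card_piFinset_const, Int.card_Icc]
    congr 1
    omega
  -- With `N ≤ 2 m^(1-b)` colours, some class of an `m`-point set has at least `u` points. Since `N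
  -- ≥ m^(1-b)`, its potential is at most `1 + C₀ = K`.
  set u : ℕ := ⌈(m : ℝ) ^ b / 2⌉₊ with hu
  set N : ℕ := ⌈(m : ℝ) ^ (1 - b)⌉₊ with hN
  have hm1 : (1 : ℝ) ≤ m := by exact_mod_cast hm
  have hm0 : (0 : ℝ) < m := by linarith
  have hN1 : 1 ≤ (m : ℝ) ^ (1 - b) := Real.one_le_rpow hm1 (by linarith)
  have hNle : (N : ℝ) ≤ 2 * (m : ℝ) ^ (1 - b) := by
    have := Nat.ceil_lt_add_one (a := (m : ℝ) ^ (1 - b)) (by positivity)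
    linarith
  have hNge : (m : ℝ) ^ (1 - b) ≤ N := Nat.le_ceil _
  have hN0 : 0 < N := Nat.ceil_pos.2 (by positivity)
  set 𝒰 := (Finset.powersetCard u Q).filter fun U => ∀ x ∈ U, ∑ y ∈ U, g (x - y) ≤ K with h𝒰
  have hcover : ∀ᵐ ω ∂μ, ω ∈ {ω | m ≤ (levelSet (fun k => S k ω) n t).card} →
      ω ∈ ⋃ U ∈ 𝒰, {ω | t * u ≤ ∑ x ∈ U, localTime (fun k => S k ω) n x} := by
    filter_upwards [hS.ae_abs_le hd] with ω hω hmω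
    obtain ⟨Λ, hΛD, hΛm⟩ := Finset.exists_subset_card_eq (Set.mem_ofPred.1 hmω)
    obtain ⟨U', hU'Λ, hU'c, hU'g⟩ := exists_subset_sum_le Λ (fun x y => g (x - y))
      (fun x y => by rw [← hgs, neg_sub]) (fun x y => (hg0 _).le) hN0
    have huU' : u ≤ U'.card := by
      rw [hu, Nat.ceil_le]
      have h1 : (m : ℝ) ≤ N * U'.card := by rw [hΛm] at hU'c; exact_mod_cast hU'c
      have h2 : (m : ℝ) ^ (1 - b) * (m : ℝ) ^ b = m := by
        rw [← Real.rpow_add hm0, sub_add_cancel, Real.rpow_one]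
      have h3 : (m : ℝ) ^ (1 - b) * (m : ℝ) ^ b ≤ (m : ℝ) ^ (1 - b) * (2 * U'.card) := by
        rw [h2]
        calc (m : ℝ) ≤ N * U'.card := h1
          _ ≤ 2 * (m : ℝ) ^ (1 - b) * U'.card := by gcongr
          _ = _ := by ring
      have := le_of_mul_le_mul_left h3 (by positivity)
      linarith
    obtain ⟨U, hUU', hUu⟩ := Finset.exists_subset_card_eq huU'
    have hUD := hUU'.trans (hU'Λ.trans hΛD)
    refine Set.mem_biUnion (x := U) ?_ ?_
    · refine Finset.mem_coe.2 (Finset.mem_filter.2 ⟨Finset.mem_powersetCard.2 ⟨fun x hx => ?_, hUu⟩,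
        fun x hx => ?_⟩)
      · obtain ⟨k, hk, rfl⟩ := Finset.mem_image.1 (Finset.mem_filter.1 (hUD hx)).1
        rw [hQ, Fintype.mem_piFinset]
        intro i
        have h1 := abs_le.1 (hω k i)
        have h2 : (k : ℤ) ≤ n := by exact_mod_cast Nat.lt_succ_iff.1 (Finset.mem_range.1 hk)
        exact Finset.mem_Icc.2 ⟨by linarith, by linarith⟩
      · calc ∑ y ∈ U, g (x - y) ≤ ∑ y ∈ U', g (x - y) :=
              Finset.sum_le_sum_of_subset_of_nonneg hUU' fun y _ _ => (hg0 _).le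
          _ ≤ g (x - x) + (∑ y ∈ Λ, g (x - y)) / N := hU'g x (hUU' hx)
          _ ≤ 1 + C₀ * (m : ℝ) ^ (1 - b) / N := by
            gcongr
            · exact hg1 _
            · rw [← hΛm]; exact hΛ Λ x
          _ ≤ K := by
            rw [hK]
            gcongr
            rw [div_le_iff₀ (by positivity)]
            gcongr
    · change t * u ≤ _
      rw [mul_comm, ← hUu, ← smul_eq_mul]
      exact Finset.card_nsmul_le_sum _ _ _ fun x hx => (Finset.mem_filter.1 (hUD hx)).2
  have h1 : μ.real {ω | m ≤ (levelSet (fun k => S k ω) n t).card} ≤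
      ∑ U ∈ 𝒰, μ.real {ω | t * u ≤ ∑ x ∈ U, localTime (fun k => S k ω) n x} :=
    (ENNReal.toReal_mono (measure_ne_top μ _) (measure_mono_ae hcover)).trans
      (measureReal_biUnion_finset_le _ _)
  -- The prefactor `1 + u` is absorbed in `2 ^ u`, so that the whole union bound becomes a `u`-th
  -- power.
  have h2 : ∀ U ∈ 𝒰, μ.real {ω | t * u ≤ ∑ x ∈ U, localTime (fun k => S k ω) n x} ≤
      2 ^ u * (ρ ^ (t * u))⁻¹ := by
    intro U hU
    obtain ⟨hU1, hU2⟩ := Finset.mem_filter.1 hU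
    refine (hS.measureReal_le_sum_localTime_le hd hc₀ (by positivity) hg0 hg1 hsup hsup0 hU2 n
      (t * u)).trans ?_
    rw [(Finset.mem_powersetCard.1 hU1).2]
    gcongr
    have : u + 1 ≤ 2 ^ u := Nat.lt_two_pow_self
    rw [add_comm]
    exact_mod_cast this
  have h3 : (𝒰.card : ℝ) ≤ ((2 * n + 1) ^ d) ^ u := by
    have : 𝒰.card ≤ ((2 * n + 1) ^ d) ^ u := by
      refine (Finset.card_filter_le _ _).trans ?_
      rw [Finset.card_powersetCard, hQc]
      exact Nat.choose_le_pow _ _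
    exact_mod_cast this
  have h4 : (2 * n + 1 : ℝ) ^ d * 2 ≤ Real.exp (Real.log ρ / 2 * t) := by
    have hn2 : (2 : ℝ) ≤ n + 2 := by linarith [(n.cast_nonneg : (0 : ℝ) ≤ n)]
    calc (2 * n + 1 : ℝ) ^ d * 2 ≤ ((n + 2 : ℝ) ^ 2) ^ d * (n + 2) := by
          gcongr
          nlinarith
      _ = (n + 2 : ℝ) ^ (2 * d + 1) := by rw [← pow_mul, pow_succ]
      _ = Real.exp ((2 * d + 1) * Real.log (n + 2)) := by
        rw [← Real.exp_log (show (0 : ℝ) < n + 2 by linarith), ← Real.exp_nat_mul, Real.log_exp]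
        push_cast
        rfl
      _ ≤ _ := by
        rw [Real.exp_le_exp]
        have h5 : 2 * (2 * d + 1) / Real.log ρ * Real.log (n + 2) * (Real.log ρ / 2) ≤
          t * (Real.log ρ / 2) := by gcongr
        have h6 : 2 * (2 * d + 1) / Real.log ρ * Real.log (n + 2) * (Real.log ρ / 2) =
          (2 * d + 1) * Real.log (n + 2) := by field_simp
        linarith
  have h7 : (ρ ^ (t * u))⁻¹ = Real.exp (-(Real.log ρ * t)) ^ u := by
    rw [← Real.exp_nat_mul, pow_mul, ← inv_pow, ← inv_pow]
    rw [Real.exp_nat_mul]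
    congr 1
    rw [mul_comm, ← mul_neg, mul_neg, ← neg_mul, neg_mul_comm, Real.exp_nat_mul, Real.exp_neg,
      Real.exp_log hρ0]
  calc μ.real {ω | m ≤ (levelSet (fun k => S k ω) n t).card}
      ≤ ∑ U ∈ 𝒰, μ.real {ω | t * u ≤ ∑ x ∈ U, localTime (fun k => S k ω) n x} := h1
    _ ≤ 𝒰.card * (2 ^ u * (ρ ^ (t * u))⁻¹) := by
      rw [← nsmul_eq_mul]
      exact Finset.sum_le_card_nsmul _ _ _ h2
    _ ≤ ((2 * n + 1) ^ d) ^ u * (2 ^ u * (ρ ^ (t * u))⁻¹) := by gcongr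
    _ = ((2 * n + 1) ^ d * 2 * Real.exp (-(Real.log ρ * t))) ^ u := by
      rw [h7, mul_pow, mul_pow]; ring
    _ ≤ (Real.exp (Real.log ρ / 2 * t) * Real.exp (-(Real.log ρ * t))) ^ u := by gcongr
    _ = Real.exp (-(Real.log ρ / 2 * t * u)) := by
      rw [← Real.exp_add, ← Real.exp_nat_mul]
      congr 1
      ring
    _ ≤ _ := by
      rw [Real.exp_le_exp]
      have h8 : (m : ℝ) ^ b / 2 ≤ u := Nat.le_ceil _
      have h9 : Real.log ρ / 2 * t * ((m : ℝ) ^ b / 2) ≤ Real.log ρ / 2 * t * u := by gcongr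
      linarith

/-- At height `2 ^ j` the threshold is `m ≈ (W / 2 ^ j) ^ (1 / b)` sites, so every level costs the
same `exp(-c W)` and only the number of levels is lost. -/
theorem exists_measureReal_dyadic_le {d : ℕ} (hd : 0 < d) {b : ℝ} (hb : 0 < b)
    (hbd : b < 1 - 2 / (d : ℝ)) :
    ∃ c > (0 : ℝ), ∃ C > (0 : ℝ), ∀ (Ω : Type*) [MeasurableSpace Ω] (μ : Measure Ω)
      [IsProbabilityMeasure μ] (S : ℕ → Ω → (Fin d → ℤ)), IsSimpleRandomWalk μ d S →
      ∀ (n j₀ : ℕ) (W : ℝ), C * Real.log (n + 2) ≤ 2 ^ j₀ → 0 < W →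
        μ.real {ω | ∃ j ∈ Finset.Ico j₀ (Nat.log 2 (n + 1) + 1),
          W ≤ 2 ^ j * ((levelSet (fun k => S k ω) n (2 ^ j)).card : ℝ) ^ b} ≤
          (Nat.log 2 (n + 1) + 1) * Real.exp (-c * W) := by
  obtain ⟨c, hc, C, hC, H⟩ := exists_measureReal_card_levelSet_le hd hb hbd
  refine ⟨c, hc, C, hC, ?_⟩
  intro Ω _ μ _ S hS n j₀ W hj₀ hW
  set J := Finset.Ico j₀ (Nat.log 2 (n + 1) + 1)
  have h1 : {ω | ∃ j ∈ J, W ≤ 2 ^ j * ((levelSet (fun k => S k ω) n (2 ^ j)).card : ℝ) ^ b} =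
      ⋃ j ∈ J, {ω | W ≤ 2 ^ j * ((levelSet (fun k => S k ω) n (2 ^ j)).card : ℝ) ^ b} := by
    ext ω; simp
  have h2 : ∀ j ∈ J, μ.real {ω | W ≤ 2 ^ j *
      ((levelSet (fun k => S k ω) n (2 ^ j)).card : ℝ) ^ b} ≤ Real.exp (-c * W) := by
    intro j hj
    have h2j : (0 : ℝ) < 2 ^ j := by positivity
    set m : ℕ := ⌈(W / 2 ^ j) ^ (1 / b)⌉₊ with hm
    have hm1 : 1 ≤ m := Nat.ceil_pos.2 (by positivity)
    have hmW : W ≤ 2 ^ j * (m : ℝ) ^ b := by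
      rw [← div_le_iff₀' h2j]
      calc W / 2 ^ j = ((W / 2 ^ j) ^ (1 / b)) ^ b := by
            rw [← Real.rpow_mul (by positivity), one_div_mul_cancel hb.ne', Real.rpow_one]
        _ ≤ (m : ℝ) ^ b := by
          gcongr
          exact Nat.le_ceil _
    have hsub : {ω | W ≤ 2 ^ j * ((levelSet (fun k => S k ω) n (2 ^ j)).card : ℝ) ^ b} ⊆
        {ω | m ≤ (levelSet (fun k => S k ω) n (2 ^ j)).card} := by
      intro ω hω
      have hω' : W ≤ 2 ^ j * ((levelSet (fun k => S k ω) n (2 ^ j)).card : ℝ) ^ b := hω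
      rw [← div_le_iff₀' h2j] at hω'
      refine Nat.ceil_le.2 ?_
      calc (W / 2 ^ j) ^ (1 / b)
          ≤ (((levelSet (fun k => S k ω) n (2 ^ j)).card : ℝ) ^ b) ^ (1 / b) := by gcongr
        _ = _ := by
          rw [← Real.rpow_mul (by positivity), mul_one_div_cancel hb.ne', Real.rpow_one]
    refine (measureReal_mono hsub).trans ((H Ω μ S hS n (2 ^ j) m ?_ hm1).trans ?_)
    · push_cast
      exact hj₀.trans (pow_le_pow_right₀ one_le_two (Finset.mem_Ico.1 hj).1)
    · rw [Real.exp_le_exp]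
      push_cast
      nlinarith
  rw [h1]
  refine (measureReal_biUnion_finset_le _ _).trans ((Finset.sum_le_card_nsmul _ _ _ h2).trans ?_)
  rw [nsmul_eq_mul]
  gcongr
  rw [Nat.card_Ico]
  exact_mod_cast Nat.sub_le _ _

end IsSimpleRandomWalk

/-! ### Deterministic estimates for sums over levels. -/

theorem eventually_log_le_rpow (C : ℝ) {η : ℝ} (hη : 0 < η) :
    ∀ᶠ n : ℕ in Filter.atTop, C * Real.log (n + 2) + C ≤ (n : ℝ) ^ η := by
  have h1 : Filter.Tendsto (fun n : ℕ => (n : ℝ) + 2) Filter.atTop Filter.atTop :=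
    Filter.tendsto_atTop_add_const_right _ _ tendsto_natCast_atTop_atTop
  have hε : (0 : ℝ) < 1 / (2 * (|C| + 1) * 3 ^ η) := by positivity
  have h2 := h1.eventually ((isLittleO_log_rpow_atTop hη).bound hε)
  have h3 : ∀ᶠ n : ℕ in Filter.atTop, 2 * C ≤ (n : ℝ) ^ η :=
    ((tendsto_rpow_atTop hη).comp tendsto_natCast_atTop_atTop).eventually_ge_atTop _
  filter_upwards [h2, h3, Filter.eventually_ge_atTop 1] with n hn hn' hn1
  have hn1' : (1 : ℝ) ≤ n := by exact_mod_cast hn1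
  rw [Real.norm_of_nonneg (Real.log_nonneg (by linarith)),
    Real.norm_of_nonneg (by positivity)] at hn
  have h4 : ((n : ℝ) + 2) ^ η ≤ 3 ^ η * (n : ℝ) ^ η := by
    rw [← Real.mul_rpow (by norm_num) (by linarith)]
    gcongr
    linarith
  have h5 : C * Real.log (n + 2) ≤ (n : ℝ) ^ η / 2 := by
    calc C * Real.log (n + 2) ≤ (|C| + 1) * Real.log (n + 2) := by
          gcongr
          · exact Real.log_nonneg (by linarith)
          · linarith [le_abs_self C]
      _ ≤ (|C| + 1) * (1 / (2 * (|C| + 1) * 3 ^ η) * (3 ^ η * (n : ℝ) ^ η)) := by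
        gcongr
        exact hn.trans (by gcongr)
      _ = (n : ℝ) ^ η / 2 := by field_simp
  linarith

theorem natLog_two_add_one_le (n : ℕ) :
    (Nat.log 2 (n + 1) : ℝ) + 1 ≤ 2 * Real.log (n + 2) + 2 := by
  have h1 : (2 : ℝ) ^ Nat.log 2 (n + 1) ≤ n + 2 := by
    have := Nat.pow_log_le_self 2 (Nat.succ_ne_zero n)
    have h : ((2 ^ Nat.log 2 (n + 1) : ℕ) : ℝ) ≤ ((n + 1 : ℕ) : ℝ) := by exact_mod_cast this
    push_cast at h
    linarith
  have h2 := Real.log_le_log (by positivity) h1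
  rw [Real.log_pow] at h2
  have h3 := Real.log_two_gt_d9
  have h4 : (Nat.log 2 (n + 1) : ℝ) * (1 / 2) ≤ Nat.log 2 (n + 1) * Real.log 2 := by
    gcongr
    linarith
  linarith

/-- For large `n` the sites of at most logarithmic local time contribute less than half of `n^γ`. -/
theorem eventually_exists_low_levels (C : ℝ) (hC : 0 ≤ C) {p γ : ℝ} (hp : 1 < p) (hγ : 1 < γ) :
    ∀ᶠ n : ℕ in Filter.atTop, ∃ j₀ : ℕ, C * Real.log (n + 2) ≤ 2 ^ j₀ ∧
      ((2 : ℝ) ^ j₀) ^ (p - 1) * (n + 1) ≤ (n : ℝ) ^ γ / 2 := by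
  -- Half of the excess `γ - 1` absorbs the power `p - 1` of the height; the other half absorbs the
  -- constants.
  have hη : 0 < (γ - 1) / 2 / (p - 1) := div_pos (by linarith) (by linarith)
  have h1 : ∀ᶠ n : ℕ in Filter.atTop, 4 ≤ (n : ℝ) ^ ((γ - 1) / 2) :=
    ((tendsto_rpow_atTop (by linarith)).comp tendsto_natCast_atTop_atTop).eventually_ge_atTop _
  filter_upwards [eventually_log_le_rpow (2 * C + 2) hη, h1, Filter.eventually_ge_atTop 1]
    with n hn hn4 hn1
  have hn1' : (1 : ℝ) ≤ n := by exact_mod_cast hn1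
  have hlog : 0 ≤ Real.log ((n : ℝ) + 2) := Real.log_nonneg (by linarith)
  obtain ⟨j, hj1, hj2⟩ := exists_nat_pow_near (x := C * Real.log (n + 2) + 1) (y := (2 : ℝ))
    (by linarith [mul_nonneg hC hlog]) one_lt_two
  refine ⟨j + 1, by linarith, ?_⟩
  have h2 : (2 : ℝ) ^ (j + 1) ≤ (n : ℝ) ^ ((γ - 1) / 2 / (p - 1)) := by
    rw [pow_succ]
    nlinarith
  calc ((2 : ℝ) ^ (j + 1)) ^ (p - 1) * (n + 1)
      ≤ ((n : ℝ) ^ ((γ - 1) / 2 / (p - 1))) ^ (p - 1) * (2 * n) := by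
        gcongr
        linarith
    _ = (n : ℝ) ^ ((γ - 1) / 2) * (2 * n) := by
      rw [← Real.rpow_mul (by linarith), div_mul_cancel₀ _ (by linarith)]
    _ ≤ (n : ℝ) ^ ((γ - 1) / 2) * (((n : ℝ) ^ ((γ - 1) / 2) / 2) * n) := by
      gcongr
      linarith
    _ = (n : ℝ) ^ ((γ - 1) / 2 + (γ - 1) / 2 + 1) / 2 := by
      rw [Real.rpow_add (by linarith), Real.rpow_add (by linarith), Real.rpow_one]
      ring
    _ = _ := by
      congr 2
      ring

theorem sum_two_pow_rpow_le {κ W : ℝ} (hκ : 0 < κ) (hW : 1 ≤ W) (J : Finset ℕ) :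
    ∑ j ∈ J, (if (2 : ℝ) ^ j ≤ W then ((2 : ℝ) ^ j) ^ κ else 0) ≤
      (2 : ℝ) ^ κ / ((2 : ℝ) ^ κ - 1) * W ^ κ := by
  obtain ⟨k, hk1, hk2⟩ := exists_nat_pow_near hW (one_lt_two (α := ℝ))
  have hr : 1 < (2 : ℝ) ^ κ := Real.one_lt_rpow one_lt_two hκ
  have hr' : 0 < (2 : ℝ) ^ κ - 1 := by linarith
  have hpow : ∀ j : ℕ, ((2 : ℝ) ^ j) ^ κ = ((2 : ℝ) ^ κ) ^ j := fun j => by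
    rw [← Real.rpow_natCast, ← Real.rpow_natCast, ← Real.rpow_mul (by norm_num),
      ← Real.rpow_mul (by norm_num), mul_comm]
  rw [← Finset.sum_filter]
  calc ∑ j ∈ J with (2 : ℝ) ^ j ≤ W, ((2 : ℝ) ^ j) ^ κ
      ≤ ∑ j ∈ Finset.range (k + 1), ((2 : ℝ) ^ j) ^ κ := by
        refine Finset.sum_le_sum_of_subset_of_nonneg (fun j hj => ?_) fun j _ _ => by positivity
        rw [Finset.mem_range]
        exact (pow_lt_pow_iff_right₀ (one_lt_two (α := ℝ))).1
          ((Finset.mem_filter.1 hj).2.trans_lt hk2)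
    _ = (((2 : ℝ) ^ κ) ^ (k + 1) - 1) / ((2 : ℝ) ^ κ - 1) := by
      simp only [hpow]
      exact geom_sum_eq hr.ne' _
    _ ≤ (2 : ℝ) ^ κ * W ^ κ / ((2 : ℝ) ^ κ - 1) := by
      gcongr
      have : ((2 : ℝ) ^ k) ^ κ ≤ W ^ κ := by gcongr
      rw [pow_succ', ← hpow]
      nlinarith
    _ = _ := by ring

/-- A nonempty level forces `2 ^ j ≤ W`, and each term is at most a constant times `W ^ (1 / b) * (2
^ j) ^ κ`. Since `κ > 0` the geometric sum is governed by its top term, `2 ^ j` of order `W`. -/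
theorem sum_levels_le_of_lt {κ b p W : ℝ} (hb : 0 < b) (hκ : κ = p - 1 / b) (hκ0 : 0 < κ)
    (hW : 1 ≤ W) (J : Finset ℕ) (D : ℕ → ℕ) (hD : ∀ j ∈ J, 2 ^ j * (D j : ℝ) ^ b < W) :
    ∑ j ∈ J, (D j : ℝ) * (2 * (2 : ℝ) ^ j) ^ p ≤
      2 ^ p * ((2 : ℝ) ^ κ / ((2 : ℝ) ^ κ - 1)) * W ^ p := by
  have hterm : ∀ j ∈ J, (D j : ℝ) * (2 * (2 : ℝ) ^ j) ^ p ≤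
      2 ^ p * W ^ (1 / b) * (if (2 : ℝ) ^ j ≤ W then ((2 : ℝ) ^ j) ^ κ else 0) := by
    intro j hj
    have h2j : (0 : ℝ) < 2 ^ j := by positivity
    have hDj := hD j hj
    rcases Nat.eq_zero_or_pos (D j) with h0 | h0
    · rw [h0, Nat.cast_zero, zero_mul]
      split_ifs <;> positivity
    · have hD1 : (1 : ℝ) ≤ D j := by exact_mod_cast h0
      have hDb : 1 ≤ (D j : ℝ) ^ b := Real.one_le_rpow hD1 hb.le
      rw [if_pos (by nlinarith)]
      have h3 : (D j : ℝ) ≤ (W / 2 ^ j) ^ (1 / b) := by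
        calc (D j : ℝ) = ((D j : ℝ) ^ b) ^ (1 / b) := by
              rw [← Real.rpow_mul (by positivity), mul_one_div_cancel hb.ne', Real.rpow_one]
          _ ≤ _ := by
            gcongr
            rw [le_div_iff₀ h2j, mul_comm]
            exact hDj.le
      calc (D j : ℝ) * (2 * (2 : ℝ) ^ j) ^ p
          ≤ (W / 2 ^ j) ^ (1 / b) * (2 * (2 : ℝ) ^ j) ^ p := by gcongr
        _ = _ := by
          rw [Real.div_rpow (by linarith) h2j.le, Real.mul_rpow (by norm_num) h2j.le, hκ,
            Real.rpow_sub h2j]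
          ring
  refine (Finset.sum_le_sum hterm).trans ?_
  rw [← Finset.mul_sum]
  calc _ ≤ 2 ^ p * W ^ (1 / b) * ((2 : ℝ) ^ κ / ((2 : ℝ) ^ κ - 1) * W ^ κ) := by
        gcongr
        exact sum_two_pow_rpow_le hκ0 hW J
    _ = 2 ^ p * ((2 : ℝ) ^ κ / ((2 : ℝ) ^ κ - 1)) * (W ^ (1 / b) * W ^ κ) := by ring
    _ = _ := by
      rw [← Real.rpow_add (by linarith)]
      congr 2
      linarith

/-- Interpolation: `θ` solves `θ / b + (1 - θ) = p`, so `D T^p` is the product of `(T D^b)^(θ/b)`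
and `(D T)^(1-θ)`. The condition `p ≤ 1 / b` amounts to `θ ≤ 1`. -/
theorem level_le_of_lt {b p θ W M T D : ℝ} (hb : 0 < b) (hθ : θ = (p - 1) / (1 / b - 1)) (hb1 : b < 1)
    (hp : 1 < p) (hpb : p ≤ 1 / b) (hT : 0 < T) (hD : 0 ≤ D) (h1 : T * D ^ b < W) (h2 : D * T ≤ M) :
    D * (2 * T) ^ p ≤ 2 ^ p * (W ^ (θ / b) * M ^ (1 - θ)) := by
  have hb2 : 0 < 1 / b - 1 := by
    rw [sub_pos, lt_div_iff₀ hb]; linarith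
  have hθ0 : 0 < θ := by rw [hθ]; exact div_pos (by linarith) hb2
  have hθ1 : θ ≤ 1 := by rw [hθ, div_le_one hb2]; linarith
  have hθp : θ / b + (1 - θ) = p := by
    have : θ * (1 / b - 1) = p - 1 := by rw [hθ, div_mul_cancel₀ _ hb2.ne']
    have h : θ / b = θ * (1 / b) := by ring
    rw [h]; linarith
  rcases hD.eq_or_lt with rfl | hD0
  · rw [zero_mul]
    have hM : 0 ≤ M := by simpa using h2
    have hW : 0 < W := by
      refine lt_of_le_of_lt ?_ h1
      positivity
    positivity
  have e : D * T ^ p = (T * D ^ b) ^ (θ / b) * (D * T) ^ (1 - θ) := by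
    rw [Real.mul_rpow hT.le (by positivity), Real.mul_rpow hD0.le hT.le, ← Real.rpow_mul hD0.le,
      mul_div_cancel₀ _ hb.ne']
    calc D * T ^ p = D ^ (θ + (1 - θ)) * T ^ (θ / b + (1 - θ)) := by
          rw [hθp, add_sub_cancel, Real.rpow_one]
      _ = _ := by
        rw [Real.rpow_add hD0, Real.rpow_add hT]; ring
  rw [Real.mul_rpow (by norm_num) hT.le, mul_left_comm, e]
  have : 0 ≤ 1 - θ := by linarith
  have hW : 0 ≤ W := le_trans (by positivity) h1.le
  gcongr

/-! ### The two upper bounds. -/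

namespace IsSimpleRandomWalk

theorem exists_upper_bound_of_large_exponent {d : ℕ} (hd : 2 < d) {p γ : ℝ}
    (hp : (d : ℝ) / ((d : ℝ) - 2) < p) (hγ : 1 < γ) :
    ∃ c > (0 : ℝ), ∀ᶠ n : ℕ in Filter.atTop,
      ∀ (Ω : Type*) [MeasurableSpace Ω] (μ : Measure Ω) [IsProbabilityMeasure μ]
        (S : ℕ → Ω → (Fin d → ℤ)), IsSimpleRandomWalk μ d S →
        μ.real {ω | (n : ℝ) ^ γ < localTimePowerSum (fun k => S k ω) n p} ≤
          Real.exp (-c * (n : ℝ) ^ (γ / p)) := by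
  have hd2 : (2 : ℝ) < d := by exact_mod_cast hd
  have hd0 : (0 : ℝ) < d := by linarith
  have hp1 : 1 < p := lt_trans (by rw [lt_div_iff₀] <;> linarith) hp
  have hp0 : 0 < p := by linarith
  have hbd : 1 / p < 1 - 2 / (d : ℝ) := by
    rw [div_lt_iff₀ (by linarith)] at hp
    rw [div_lt_iff₀ hp0, one_sub_div hd0.ne', div_mul_eq_mul_div, lt_div_iff₀ hd0]
    linarith
  -- The condition `p > d/(d-2)` is exactly the room for `1/p < b < 1 - 2/d`.
  obtain ⟨b, hb1, hb2⟩ := exists_between hbd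
  have hb0 : 0 < b := lt_trans (by positivity) hb1
  have hκ : 0 < p - 1 / b := by
    rw [sub_pos]
    exact (one_div_lt hp0 hb0).1 hb1
  obtain ⟨c, hc, C, hC, H⟩ := exists_measureReal_dyadic_le (d := d) (by omega) hb0 hb2
  set A : ℝ := 2 ^ p * ((2 : ℝ) ^ (p - 1 / b) / ((2 : ℝ) ^ (p - 1 / b) - 1)) with hA
  have hA0 : 0 < A := by
    have : 1 < (2 : ℝ) ^ (p - 1 / b) := Real.one_lt_rpow one_lt_two hκ
    have : 0 < (2 : ℝ) ^ (p - 1 / b) - 1 := by linarith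
    positivity
  -- Chosen so that with `W = ε n^(γ/p)` the high levels total at most `A W^p = n^γ / 2`.
  set ε : ℝ := (1 / (2 * A)) ^ (1 / p) with hε
  have hε0 : 0 < ε := by positivity
  have hεp : ε ^ p = 1 / (2 * A) := by
    rw [hε, ← Real.rpow_mul (by positivity), one_div_mul_cancel hp0.ne', Real.rpow_one]
  have hγp : 0 < γ / p := by positivity
  refine ⟨c * ε / 2, by positivity, ?_⟩
  have hWev : ∀ᶠ n : ℕ in Filter.atTop, 1 / ε ≤ (n : ℝ) ^ (γ / p) :=
    ((tendsto_rpow_atTop hγp).comp tendsto_natCast_atTop_atTop).eventually_ge_atTop _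
  filter_upwards [eventually_exists_low_levels C hC.le hp1 hγ, hWev,
    eventually_log_le_rpow (2 / (c * ε) * 2) hγp] with n hlow hnW hnlog
  intro Ω _ μ _ S hS
  obtain ⟨j₀, hj1, hj2⟩ := hlow
  set W : ℝ := ε * (n : ℝ) ^ (γ / p) with hW
  have hW1 : 1 ≤ W := by
    rw [div_le_iff₀ hε0] at hnW
    rw [hW]; linarith
  have hWp : A * W ^ p = (n : ℝ) ^ γ / 2 := by
    rw [hW, Real.mul_rpow hε0.le (by positivity), hεp, ← Real.rpow_mul (by positivity),
      div_mul_cancel₀ _ hp0.ne']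
    field_simp
  have hsub : {ω | (n : ℝ) ^ γ < localTimePowerSum (fun k => S k ω) n p} ⊆
      {ω | ∃ j ∈ Finset.Ico j₀ (Nat.log 2 (n + 1) + 1),
          W ≤ 2 ^ j * ((levelSet (fun k => S k ω) n (2 ^ j)).card : ℝ) ^ b} := by
    intro ω hω
    change ∃ j ∈ Finset.Ico j₀ (Nat.log 2 (n + 1) + 1),
          W ≤ 2 ^ j * ((levelSet (fun k => S k ω) n (2 ^ j)).card : ℝ) ^ b
    by_contra! hcon
    have h1 := localTimePowerSum_le (fun k => S k ω) n hp1 j₀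
    have h2 := sum_levels_le_of_lt hb0 rfl hκ hW1 _
      (fun j => (levelSet (fun k => S k ω) n (2 ^ j)).card) hcon
    rw [← hA, hWp] at h2
    have h3 : (n : ℝ) ^ γ < localTimePowerSum (fun k => S k ω) n p := hω
    linarith
  have hL : (Nat.log 2 (n + 1) : ℝ) + 1 ≤ Real.exp (c * W / 2) := by
    have h1 : (2 / (c * ε)) * (Nat.log 2 (n + 1) + 1) ≤ (n : ℝ) ^ (γ / p) := by
      refine le_trans ?_ hnlog
      calc (2 / (c * ε)) * ((Nat.log 2 (n + 1) : ℝ) + 1)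
          ≤ (2 / (c * ε)) * (2 * Real.log (n + 2) + 2) := by
            exact mul_le_mul_of_nonneg_left (natLog_two_add_one_le n) (by positivity)
        _ = _ := by ring
    rw [div_mul_eq_mul_div, div_le_iff₀ (by positivity)] at h1
    have h2 := Real.add_one_le_exp (c * W / 2)
    rw [hW] at h2 ⊢
    linarith
  calc _ ≤ _ := measureReal_mono hsub
    _ ≤ (Nat.log 2 (n + 1) + 1) * Real.exp (-c * W) := H Ω μ S hS n j₀ W hj1 (by linarith)
    _ ≤ Real.exp (c * W / 2) * Real.exp (-c * W) := by gcongr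
    _ = _ := by
      rw [← Real.exp_add, hW]
      congr 1
      ring

theorem exists_upper_bound_of_small_exponent {d : ℕ} (hd : 2 < d) {p γ ζ ε : ℝ} (hp1 : 1 < p)
    (hp : p ≤ (d : ℝ) / ((d : ℝ) - 2)) (hγ : 1 < γ) (hγp : γ < p)
    (hζ : ζ = 1 - (2 / (d : ℝ)) * ((p - γ) / (p - 1))) (hε : 0 < ε) :
    ∃ c > (0 : ℝ), ∀ᶠ n : ℕ in Filter.atTop,
      ∀ (Ω : Type*) [MeasurableSpace Ω] (μ : Measure Ω) [IsProbabilityMeasure μ]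
        (S : ℕ → Ω → (Fin d → ℤ)), IsSimpleRandomWalk μ d S →
        μ.real {ω | (n : ℝ) ^ γ < localTimePowerSum (fun k => S k ω) n p} ≤
          Real.exp (-c * (n : ℝ) ^ (ζ - ε)) := by
  have hd2 : (2 : ℝ) < d := by exact_mod_cast hd
  have hd0 : (0 : ℝ) < d := by linarith
  have hp0 : 0 < p := by linarith
  have hq1 : (p - γ) / (p - 1) < 1 := by
    rw [div_lt_one] <;> linarith
  have hq0 : 0 < (p - γ) / (p - 1) := div_pos (by linarith) (by linarith)
  have h2d : 0 < 2 / (d : ℝ) := by positivity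
  have h2d1 : 2 / (d : ℝ) < 1 := by rw [div_lt_one hd0]; exact hd2
  set δ : ℝ := min (ε / 2) ((1 - 2 / (d : ℝ)) / 2) with hδ
  have hδ0 : 0 < δ := lt_min (by linarith) (by linarith)
  have hδε : δ ≤ ε / 2 := min_le_left _ _
  have hδd : δ ≤ (1 - 2 / (d : ℝ)) / 2 := min_le_right _ _
  set b : ℝ := 1 - 2 / (d : ℝ) - δ with hb
  have hb0 : 0 < b := by linarith
  have hb1 : b < 1 := by linarith
  have hpb : p ≤ 1 / b := by
    rw [le_div_iff₀ (by linarith)] at hp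
    rw [le_div_iff₀ hb0]
    have : p * (1 - 2 / (d : ℝ)) ≤ 1 := by
      rw [one_sub_div hd0.ne', ← mul_div_assoc, div_le_one hd0]
      exact hp
    nlinarith
  set θ : ℝ := (p - 1) / (1 / b - 1) with hθ
  have hbb : 0 < 1 / b - 1 := by
    rw [sub_pos, lt_div_iff₀ hb0]; linarith
  have hθ0 : 0 < θ := div_pos (by linarith) hbb
  have hθ1 : θ ≤ 1 := by rw [hθ, div_le_one hbb]; linarith
  -- The maximum keeps the exponent of `W` positive even when `ζ - ε` is not, so that `W` still
  -- beats the logarithmic number of levels.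
  set w : ℝ := max (ζ - ε) (δ / 2) with hw
  have hw0 : 0 < w := lt_of_lt_of_le (by linarith) (le_max_right _ _)
  have hwb : w < 1 - (2 / (d : ℝ) + δ) * ((p - γ) / (p - 1)) := by
    refine max_lt ?_ ?_
    · rw [hζ]
      nlinarith
    · nlinarith
  -- Taking `w = 1 - (2/d + δ)(p-γ)/(p-1)` would give equality. Being strictly below it leaves a
  -- power `n^(γ-σ)` to absorb the number of levels.
  have hσ : w * (θ / b) + (1 - θ) < γ := by
    have e1 : 1 - (2 / (d : ℝ) + δ) = b := by rw [hb]; ring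
    have e2 : θ * (1 / b - 1) = p - 1 := by rw [hθ, div_mul_cancel₀ _ hbb.ne']
    have e3 : (1 - (2 / (d : ℝ) + δ) * ((p - γ) / (p - 1))) * (θ / b) + (1 - θ) = γ := by
      have e4 : 2 / (d : ℝ) + δ = 1 - b := by linarith
      rw [e4]
      have e5 : (1 - b) * (θ / b) = p - 1 := by rw [← e2]; field_simp
      have hp1' : p - 1 ≠ 0 := by linarith
      have e6 : θ / b = θ + (p - 1) := by
        rw [← e5]; field_simp; ring
      calc (1 - (1 - b) * ((p - γ) / (p - 1))) * (θ / b) + (1 - θ)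
          = θ / b - (1 - b) * (θ / b) * ((p - γ) / (p - 1)) + (1 - θ) := by ring
        _ = θ + (p - 1) - (p - 1) * ((p - γ) / (p - 1)) + (1 - θ) := by rw [e5, e6]
        _ = γ := by rw [mul_div_cancel₀ _ hp1']; ring
    have : w * (θ / b) < (1 - (2 / (d : ℝ) + δ) * ((p - γ) / (p - 1))) * (θ / b) := by
      gcongr
    linarith
  set σ : ℝ := w * (θ / b) + (1 - θ) with hσdef
  obtain ⟨c, hc, C, hC, H⟩ := exists_measureReal_dyadic_le (d := d) (by omega) hb0
    (show b < 1 - 2 / (d : ℝ) by linarith)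
  refine ⟨c / 2, by positivity, ?_⟩
  filter_upwards [eventually_exists_low_levels C hC.le hp1 hγ, Filter.eventually_ge_atTop 1,
    eventually_log_le_rpow (2 / c * 2) hw0,
    eventually_log_le_rpow (2 * 2 * 2 ^ p * 2) (sub_pos.2 hσ)] with n hlow hn1 hnlog hnσ
  intro Ω _ μ _ S hS
  obtain ⟨j₀, hj1, hj2⟩ := hlow
  have hn1' : (1 : ℝ) ≤ n := by exact_mod_cast hn1
  have hn0 : (0 : ℝ) < n := by linarith
  set W : ℝ := (n : ℝ) ^ w with hW
  have hW0 : 0 < W := by positivity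
  have hsub : {ω | (n : ℝ) ^ γ < localTimePowerSum (fun k => S k ω) n p} ⊆
      {ω | ∃ j ∈ Finset.Ico j₀ (Nat.log 2 (n + 1) + 1),
          W ≤ 2 ^ j * ((levelSet (fun k => S k ω) n (2 ^ j)).card : ℝ) ^ b} := by
    intro ω hω
    change ∃ j ∈ Finset.Ico j₀ (Nat.log 2 (n + 1) + 1),
          W ≤ 2 ^ j * ((levelSet (fun k => S k ω) n (2 ^ j)).card : ℝ) ^ b
    by_contra! hcon
    have h1 := localTimePowerSum_le (fun k => S k ω) n hp1 j₀
    have hterm : ∀ j ∈ Finset.Ico j₀ (Nat.log 2 (n + 1) + 1),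
        ((levelSet (fun k => S k ω) n (2 ^ j)).card : ℝ) * (2 * (2 : ℝ) ^ j) ^ p ≤
          2 ^ p * (2 * (n : ℝ) ^ σ) := by
      intro j hj
      have h4 : ((levelSet (fun k => S k ω) n (2 ^ j)).card : ℝ) * 2 ^ j ≤ n + 1 := by
        exact_mod_cast card_levelSet_mul_le (fun k => S k ω) n (2 ^ j)
      refine (level_le_of_lt hb0 hθ hb1 hp1 hpb (by positivity) (by positivity) (hcon j hj)
        h4).trans ?_
      refine mul_le_mul_of_nonneg_left ?_ (by positivity)
      calc W ^ (θ / b) * ((n : ℝ) + 1) ^ (1 - θ)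
          ≤ (n : ℝ) ^ (w * (θ / b)) * (2 * (n : ℝ) ^ (1 - θ)) := by
            rw [hW, ← Real.rpow_mul hn0.le]
            gcongr
            calc ((n : ℝ) + 1) ^ (1 - θ) ≤ (2 * n) ^ (1 - θ) := by
                  have : 0 ≤ 1 - θ := by linarith
                  gcongr
                  linarith
              _ = 2 ^ (1 - θ) * (n : ℝ) ^ (1 - θ) := Real.mul_rpow (by norm_num) hn0.le
              _ ≤ 2 * (n : ℝ) ^ (1 - θ) := by
                gcongr
                calc (2 : ℝ) ^ (1 - θ) ≤ 2 ^ (1 : ℝ) := by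
                      gcongr
                      · norm_num
                      · linarith
                  _ = 2 := Real.rpow_one 2
        _ = 2 * (n : ℝ) ^ σ := by rw [hσdef, Real.rpow_add hn0]; ring
    have h2 := Finset.sum_le_card_nsmul _ _ _ hterm
    rw [nsmul_eq_mul, Nat.card_Ico] at h2
    have h5 : ((Nat.log 2 (n + 1) + 1 - j₀ : ℕ) : ℝ) * (2 ^ p * (2 * (n : ℝ) ^ σ)) ≤
        (n : ℝ) ^ γ / 2 := by
      calc ((Nat.log 2 (n + 1) + 1 - j₀ : ℕ) : ℝ) * (2 ^ p * (2 * (n : ℝ) ^ σ))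
          ≤ (2 * Real.log (n + 2) + 2) * (2 ^ p * (2 * (n : ℝ) ^ σ)) := by
            gcongr
            refine le_trans ?_ (natLog_two_add_one_le n)
            exact_mod_cast Nat.sub_le _ _
        _ = (2 * 2 * 2 ^ p * 2 * Real.log (n + 2) + 2 * 2 * 2 ^ p * 2) * (n : ℝ) ^ σ / 2 := by ring
        _ ≤ (n : ℝ) ^ (γ - σ) * (n : ℝ) ^ σ / 2 := by gcongr
        _ = _ := by rw [← Real.rpow_add hn0, sub_add_cancel]
    have h3 : (n : ℝ) ^ γ < localTimePowerSum (fun k => S k ω) n p := hω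
    linarith
  have hL : (Nat.log 2 (n + 1) : ℝ) + 1 ≤ Real.exp (c * W / 2) := by
    have h1 : (2 / c) * (Nat.log 2 (n + 1) + 1) ≤ W := by
      refine le_trans ?_ hnlog
      calc (2 / c) * ((Nat.log 2 (n + 1) : ℝ) + 1)
          ≤ (2 / c) * (2 * Real.log (n + 2) + 2) := by
            exact mul_le_mul_of_nonneg_left (natLog_two_add_one_le n) (by positivity)
        _ = _ := by ring
    rw [div_mul_eq_mul_div, div_le_iff₀ (by positivity)] at h1
    have h2 := Real.add_one_le_exp (c * W / 2)
    linarith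
  calc _ ≤ _ := measureReal_mono hsub
    _ ≤ (Nat.log 2 (n + 1) + 1) * Real.exp (-c * W) := H Ω μ S hS n j₀ W hj1 hW0
    _ ≤ Real.exp (c * W / 2) * Real.exp (-c * W) := by gcongr
    _ = Real.exp (-(c / 2) * W) := by
      rw [← Real.exp_add]
      congr 1
      ring
    _ ≤ _ := by
      rw [Real.exp_le_exp, neg_mul, neg_mul, neg_le_neg_iff]
      exact mul_le_mul_of_nonneg_left
        (Real.rpow_le_rpow_of_exponent_le hn1' (le_max_left _ _)) (by positivity)

end IsSimpleRandomWalk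

/-! ### Lower bounds by explicit strategies. -/

theorem prod_add_single {d : ℕ} (f : ℤ → ℝ) (x : Fin d → ℤ) (i : Fin d) (s : ℤ) :
    ∏ j, f ((x + Pi.single i s : Fin d → ℤ) j) =
      f (x i + s) * ∏ j ∈ Finset.univ.erase i, f (x j) := by
  rw [← Finset.mul_prod_erase _ _ (Finset.mem_univ i)]
  congr 1
  · simp
  · refine Finset.prod_congr rfl fun j hj => ?_
    simp [Finset.ne_of_mem_erase hj]

theorem stepAvg_prod_cos {d : ℕ} (hd : 0 < d) (θ : ℝ) (x : Fin d → ℤ) :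
    stepAvg (fun x => ∏ i, Real.cos (θ * x i)) x = Real.cos θ * ∏ i, Real.cos (θ * x i) := by
  have h : ∀ i, (∏ j, Real.cos (θ * ((x + Pi.single i 1 : Fin d → ℤ) j : ℤ))) +
      ∏ j, Real.cos (θ * ((x - Pi.single i 1 : Fin d → ℤ) j : ℤ)) =
      2 * Real.cos θ * ∏ j, Real.cos (θ * x j) := by
    intro i
    rw [sub_eq_add_neg, ← Pi.single_neg, prod_add_single (fun z => Real.cos (θ * z)),
      prod_add_single (fun z => Real.cos (θ * z)),
      ← Finset.mul_prod_erase _ (fun j => Real.cos (θ * x j)) (Finset.mem_univ i)]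
    push_cast
    rw [mul_add, mul_add, mul_neg, mul_one, ← sub_eq_add_neg, Real.cos_add, Real.cos_sub]
    ring
  have hd0 : (d : ℝ) ≠ 0 := by positivity
  simp only [stepAvg, h, Finset.sum_const, Finset.card_univ, Fintype.card_fin, nsmul_eq_mul]
  field_simp

namespace IsSimpleRandomWalk

section

variable {Ω : Type*} [MeasurableSpace Ω] {μ : Measure Ω} [IsProbabilityMeasure μ] {d : ℕ}
  {S : ℕ → Ω → (Fin d → ℤ)}

/-- A space-time function which is subharmonic along the tube `B` bounds from below the probability
that the walk stays in `B`. -/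
theorem pow_mul_le_measureReal_forall_mem (hS : IsSimpleRandomWalk μ d S) (hd : 0 < d)
    {B : ℕ → Set (Fin d → ℤ)} {ψ : ℕ → (Fin d → ℤ) → ℝ} {l : ℝ} (hl : 0 ≤ l)
    (hψ : ∀ k x, |ψ k x| ≤ 1) (hψB : ∀ k, ∀ x ∉ B k, ψ k x = 0)
    (hstep : ∀ k, ∀ x ∈ B k, l * ψ k x ≤ stepAvg (ψ (k + 1)) x) (n : ℕ) :
    l ^ n * ψ 0 0 ≤ μ.real {ω | ∀ j ≤ n, S j ω ∈ B j} := by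
  classical
  set A : ℕ → Set (ℕ → (Fin d → ℤ)) := fun k => {s | ∀ j ≤ k, s j ∈ B j} with hA
  set Φ : ℕ → (ℕ → (Fin d → ℤ)) → ℝ := fun k => (A k).indicator fun _ => 1 with hΦdef
  have hΦ : ∀ k s s', (∀ j ≤ k, s j = s' j) → Φ k s = Φ k s' := by
    intro k s s' h
    have : s ∈ A k ↔ s' ∈ A k := forall₂_congr fun j hj => by rw [h j hj]
    simp only [hΦdef, Set.indicator_apply, this]
  have hΦb : ∀ k s, |Φ k s| ≤ 1 := by
    intro k s
    simp only [hΦdef, Set.indicator_apply]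
    split_ifs <;> simp
  have hΦ0 : ∀ k s, 0 ≤ Φ k s := fun k s => Set.indicator_nonneg (fun _ _ => zero_le_one) _
  -- As `ψ` vanishes off the tube, the constraint at the newest time is automatic, and the Markov
  -- property can be applied with the indicator up to time `k` only.
  have hΦψ : ∀ k s, Φ (k + 1) s * ψ (k + 1) (s (k + 1)) = Φ k s * ψ (k + 1) (s (k + 1)) := by
    intro k s
    by_cases h : s (k + 1) ∈ B (k + 1)
    · have : s ∈ A (k + 1) ↔ s ∈ A k := by
        constructor
        · exact fun hs j hj => hs j (hj.trans k.le_succ)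
        · intro hs j hj
          rcases Nat.le_succ_iff.1 hj with h' | rfl
          · exact hs j h'
          · exact h
      simp only [hΦdef, Set.indicator_apply, this]
    · rw [hψB _ _ h, mul_zero, mul_zero]
  have hint : ∀ k, Integrable (fun ω => Φ k (fun j => S j ω) * ψ k (S k ω)) μ := fun k =>
    hS.integrable_of_depends k (Φ := fun s => Φ k s * ψ k (s k))
      (fun s s' h => by simp only [hΦ k s s' h, h k le_rfl]) (C := 1) fun s => by
        rw [abs_mul]
        exact mul_le_one₀ (hΦb _ _) (abs_nonneg _) (hψ _ _)
  have habs : ∀ f : (Fin d → ℤ) → ℝ, (∀ x, |f x| ≤ 1) → ∀ x, |stepAvg f x| ≤ 1 := by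
    intro f hf x
    have hd0 : (0 : ℝ) < d := by positivity
    rw [stepAvg, abs_div, abs_of_pos (by positivity : (0 : ℝ) < 2 * d), div_le_one (by positivity)]
    refine (Finset.abs_sum_le_sum_abs _ _).trans
      ((Finset.sum_le_card_nsmul _ _ 2 fun i _ => ?_).trans ?_)
    · exact (abs_add_le _ _).trans (by linarith [hf (x + Pi.single i 1), hf (x - Pi.single i 1)])
    · simp [mul_comm]
  have hint' : ∀ k, Integrable (fun ω => Φ k (fun j => S j ω) * stepAvg (ψ (k + 1)) (S k ω)) μ :=
    fun k => hS.integrable_of_depends k (Φ := fun s => Φ k s * stepAvg (ψ (k + 1)) (s k))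
      (fun s s' h => by simp only [hΦ k s s' h, h k le_rfl]) (C := 1) fun s => by
        rw [abs_mul]
        exact mul_le_one₀ (hΦb _ _) (abs_nonneg _) (habs _ (hψ _) _)
  have main : l ^ n * ψ 0 0 ≤ ∫ ω, Φ n (fun j => S j ω) * ψ n (S n ω) ∂μ := by
    induction n with
    | zero =>
      have : ∫ ω, Φ 0 (fun j => S j ω) * ψ 0 (S 0 ω) ∂μ = ∫ _ω, ψ 0 0 ∂μ := by
        refine integral_congr_ae ?_
        filter_upwards [hS.start] with ω hω
        rw [hω]
        by_cases h : (0 : Fin d → ℤ) ∈ B 0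
        · have : (fun j => S j ω) ∈ A 0 := by
            intro j hj
            obtain rfl := Nat.le_zero.1 hj
            simpa [hω] using h
          simp only [hΦdef, Set.indicator_of_mem this, one_mul]
        · rw [hψB _ _ h, mul_zero]
      rw [this]
      simp
    | succ k ih =>
      calc l ^ (k + 1) * ψ 0 0 = l * (l ^ k * ψ 0 0) := by ring
        _ ≤ l * ∫ ω, Φ k (fun j => S j ω) * ψ k (S k ω) ∂μ := by gcongr
        _ = ∫ ω, l * (Φ k (fun j => S j ω) * ψ k (S k ω)) ∂μ := (integral_const_mul _ _).symm
        _ ≤ ∫ ω, Φ k (fun j => S j ω) * stepAvg (ψ (k + 1)) (S k ω) ∂μ := by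
          refine integral_mono ((hint k).const_mul l) (hint' k) fun ω => ?_
          change l * (Φ k (fun j => S j ω) * ψ k (S k ω)) ≤
            Φ k (fun j => S j ω) * stepAvg (ψ (k + 1)) (S k ω)
          by_cases h : (fun j => S j ω) ∈ A k
          · rw [mul_left_comm]
            exact mul_le_mul_of_nonneg_left (hstep k _ (h k le_rfl)) (hΦ0 _ _)
          · simp only [hΦdef, Set.indicator_of_notMem h, zero_mul, mul_zero, le_refl]
        _ = ∫ ω, Φ k (fun j => S j ω) * ψ (k + 1) (S (k + 1) ω) ∂μ :=
          (hS.integral_mul_succ hd k (hΦ k) (hΦb k) (hψ (k + 1))).symm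
        _ = _ := integral_congr_ae (Filter.Eventually.of_forall fun ω =>
          (hΦψ k fun j => S j ω).symm)
  refine main.trans ?_
  have hmeas : MeasurableSet {ω | ∀ j ≤ n, S j ω ∈ B j} := by
    have : {ω | ∀ j ≤ n, S j ω ∈ B j} = (fun ω => Φ n (fun j => S j ω)) ⁻¹' {1} := by
      ext ω
      change (fun j => S j ω) ∈ A n ↔ Φ n (fun j => S j ω) = 1
      simp [hΦdef, Set.indicator_apply]
    rw [this]
    exact hS.measurable_of_depends n (hΦ n) (measurableSet_singleton _)
  rw [← integral_indicator_one hmeas]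
  refine integral_mono (hint n) ((integrable_const 1).indicator hmeas) fun ω => ?_
  change Φ n (fun j => S j ω) * ψ n (S n ω) ≤ _
  have h1 := (le_abs_self _).trans (hψ n (S n ω))
  have e : Set.indicator {ω | ∀ j ≤ n, S j ω ∈ B j} (1 : Ω → ℝ) ω = Φ n (fun j => S j ω) := rfl
  rw [e]
  exact mul_le_of_le_one_right (hΦ0 _ _) h1

theorem pow_le_measureReal_follow (hS : IsSimpleRandomWalk μ d S) (hd : 0 < d)
    {a : ℕ → (Fin d → ℤ)} (ha0 : a 0 = 0)
    (ha : ∀ k, ∃ q : Fin d × ℤˣ, a (k + 1) = a k + Pi.single q.1 (q.2 : ℤ)) (n : ℕ) :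
    (1 / (2 * (d : ℝ))) ^ n ≤ μ.real {ω | ∀ j ≤ n, S j ω = a j} := by
  classical
  have h := hS.pow_mul_le_measureReal_forall_mem hd (B := fun k => {a k})
    (ψ := fun k x => if x = a k then 1 else 0) (l := 1 / (2 * (d : ℝ))) (by positivity)
    (fun k x => by split_ifs <;> simp) (fun k x hx => if_neg hx) ?_ n
  · simpa [ha0] using h
  · rintro k x hx
    obtain rfl : x = a k := hx
    obtain ⟨q, hq⟩ := ha k
    rw [stepAvg_eq_sum_units]
    refine le_trans ?_ (Finset.single_le_sum (fun q _ => ?_) (Finset.mem_univ q))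
    · simp [hq]
    · split_ifs <;> positivity

/-- The product of cosines is an eigenfunction of the step average. With `θ (R + 1) = π / 2` it
vanishes at every site reached by one step out of the box, so truncating it to the box does not
change averages at points inside. -/
theorem cos_pow_le_measureReal_box (hS : IsSimpleRandomWalk μ d S) (hd : 0 < d) (R n : ℕ) :
    Real.cos (Real.pi / (2 * (R + 1))) ^ n ≤ μ.real {ω | ∀ j ≤ n, ∀ i, |S j ω i| ≤ R} := by
  classical
  set θ := Real.pi / (2 * ((R : ℝ) + 1)) with hθ
  have hR : (0 : ℝ) < R + 1 := by positivity
  have hθR : θ * (R + 1) = Real.pi / 2 := by rw [hθ]; field_simp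
  have hθ0 : 0 ≤ θ := by positivity
  have hθ2 : θ ≤ Real.pi / 2 := by
    rw [← hθR]
    exact le_mul_of_one_le_right hθ0 (by linarith [(R.cast_nonneg : (0 : ℝ) ≤ R)])
  set Q : Set (Fin d → ℤ) := {x | ∀ i, |x i| ≤ R} with hQ
  set ψ : (Fin d → ℤ) → ℝ := fun x => ∏ i, Real.cos (θ * x i) with hψ
  have hzero : ∀ x ∈ Q, ∀ i (s : ℤˣ), x + Pi.single i (s : ℤ) ∉ Q →
      ψ (x + Pi.single i (s : ℤ)) = 0 := by
    intro x hx i s hxs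
    refine Finset.prod_eq_zero (Finset.mem_univ i) ?_
    have hxi := abs_le.1 (hx i)
    have hout : ¬ |x i + s| ≤ R := by
      intro hle
      refine hxs fun j => ?_
      by_cases hj : j = i
      · subst hj; simpa using hle
      · simpa [hj] using hx j
    have hval : x i + s = R + 1 ∨ x i + s = -(R + 1) := by
      rw [abs_le, not_and_or, not_le, not_le] at hout
      rcases Int.units_eq_one_or s with rfl | rfl
      · rw [Units.val_one] at hout ⊢; omega
      · rw [Units.val_neg, Units.val_one] at hout ⊢; omega
    rw [Pi.add_apply, Pi.single_eq_same]
    rcases hval with h | h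
    · rw [h]; push_cast; rw [hθR, Real.cos_pi_div_two]
    · rw [h]; push_cast; rw [mul_neg, hθR, Real.cos_neg, Real.cos_pi_div_two]
  have h := hS.pow_mul_le_measureReal_forall_mem hd (B := fun _ => Q)
    (ψ := fun _ => Q.indicator ψ) (l := Real.cos θ)
    (Real.cos_nonneg_of_neg_pi_div_two_le_of_le (by linarith [Real.pi_pos]) hθ2) ?_
    (fun k x hx => Set.indicator_of_notMem hx _) ?_ n
  · have h0 : (0 : Fin d → ℤ) ∈ Q := by intro i; simp
    have h1 : Q.indicator ψ 0 = 1 := by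
      rw [Set.indicator_of_mem h0]; simp [hψ]
    rw [h1, mul_one] at h
    exact h
  · intro k x
    rw [Set.indicator_apply]
    split_ifs
    · rw [hψ, Finset.abs_prod]
      exact Finset.prod_le_one (fun _ _ => abs_nonneg _) fun _ _ => Real.abs_cos_le_one _
    · simp
  · intro k x hx
    have hb : ∀ i (s : ℤˣ), Q.indicator ψ (x + Pi.single i (s : ℤ)) =
        ψ (x + Pi.single i (s : ℤ)) := by
      intro i s
      by_cases hxs : x + Pi.single i (s : ℤ) ∈ Q
      · exact Set.indicator_of_mem hxs _
      · rw [Set.indicator_of_notMem hxs, hzero x hx i s hxs]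
    have e : stepAvg (Q.indicator ψ) x = stepAvg ψ x := by
      rw [stepAvg_eq_sum_units, stepAvg_eq_sum_units]
      exact Finset.sum_congr rfl fun q _ => by rw [hb]
    rw [e, Set.indicator_of_mem hx, hψ, stepAvg_prod_cos hd]

end

/-- The walk oscillates between `0` and one neighbour for `2 ⌊n^(γ/p)⌋` steps; the local time at `0`
alone suffices. -/
theorem lower_bound_of_return {d : ℕ} (hd : 0 < d) {p γ : ℝ} (hp : 0 < p)
    (hγp : γ < p) :
    ∃ c > (0 : ℝ), ∀ᶠ n : ℕ in Filter.atTop,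
      ∀ (Ω : Type*) [MeasurableSpace Ω] (μ : Measure Ω) [IsProbabilityMeasure μ]
        (S : ℕ → Ω → (Fin d → ℤ)), IsSimpleRandomWalk μ d S →
        Real.exp (-c * (n : ℝ) ^ (γ / p)) ≤
          μ.real {ω | (n : ℝ) ^ γ < localTimePowerSum (fun k => S k ω) n p} := by
  have hd1 : (1 : ℝ) ≤ d := by exact_mod_cast hd
  have hlog : 0 < Real.log (2 * d) := Real.log_pos (by linarith)
  refine ⟨2 * Real.log (2 * d), by positivity, ?_⟩
  have hev : ∀ᶠ n : ℕ in Filter.atTop, 2 ≤ (n : ℝ) ^ (1 - γ / p) :=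
    ((tendsto_rpow_atTop (by rw [sub_pos, div_lt_one hp]; exact hγp)).comp
      tendsto_natCast_atTop_atTop).eventually_ge_atTop _
  filter_upwards [hev, Filter.eventually_ge_atTop 1] with n hn hn1
  intro Ω _ μ _ S hS
  have hn0 : (0 : ℝ) < n := by exact_mod_cast hn1
  set T : ℝ := (n : ℝ) ^ (γ / p) with hT
  have hT0 : 0 < T := by positivity
  set k : ℕ := ⌊T⌋₊ with hk
  have hkT : (k : ℝ) ≤ T := Nat.floor_le hT0.le
  have hkT' : T < k + 1 := Nat.lt_floor_add_one T
  have hkn : 2 * k ≤ n := by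
    have : (2 : ℝ) * k ≤ n := by
      calc (2 : ℝ) * k ≤ (n : ℝ) ^ (1 - γ / p) * T := by gcongr
        _ = n := by rw [hT, ← Real.rpow_add hn0, sub_add_cancel, Real.rpow_one]
    exact_mod_cast this
  set a : ℕ → (Fin d → ℤ) := fun j => if Even j then 0 else Pi.single ⟨0, hd⟩ 1 with ha
  have hfollow := hS.pow_le_measureReal_follow hd (a := a) (by simp [ha]) (fun j => by
    by_cases hj : Even j
    · exact ⟨(⟨0, hd⟩, 1), by simp [ha, hj, Nat.even_add_one]⟩
    · refine ⟨(⟨0, hd⟩, -1), ?_⟩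
      have hj' : Even (j + 1) := Nat.even_add_one.2 hj
      simp [ha, hj, hj', ← Pi.single_add]) (2 * k)
  have hsub : {ω | ∀ j ≤ 2 * k, S j ω = a j} ⊆
      {ω | (n : ℝ) ^ γ < localTimePowerSum (fun k => S k ω) n p} := by
    intro ω hω
    have hω' : ∀ j ≤ 2 * k, S j ω = a j := hω
    change (n : ℝ) ^ γ < localTimePowerSum (fun k => S k ω) n p
    -- Time `0` counts as a visit; the extra one makes the local time strictly exceed `T`.
    have hl : k + 1 ≤ localTime (fun k => S k ω) n 0 := by
      have hinj : ((Finset.range (k + 1)).image fun i => 2 * i).card = k + 1 := by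
        rw [Finset.card_image_of_injective _ (fun i j h => by simpa using h), Finset.card_range]
      rw [localTime, ← hinj, ← Finset.card_filter]
      refine Finset.card_le_card fun m hm => ?_
      obtain ⟨i, hi, rfl⟩ := Finset.mem_image.1 hm
      have hik : 2 * i ≤ 2 * k := by
        have := Finset.mem_range.1 hi
        omega
      refine Finset.mem_filter.2 ⟨Finset.mem_range.2 (by omega), ?_⟩
      rw [hω' _ hik]
      simp [ha]
    have hl' : T < (localTime (fun k => S k ω) n 0 : ℝ) := by
      have : ((k + 1 : ℕ) : ℝ) ≤ (localTime (fun k => S k ω) n 0 : ℝ) := by exact_mod_cast hl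
      push_cast at this
      linarith
    set Λ := insert (0 : Fin d → ℤ) ((Finset.range (n + 1)).image fun k => S k ω)
    rw [localTimePowerSum_eq_sum (fun k => S k ω) n hp.ne' (Λ := Λ) fun j hj =>
      Finset.mem_insert_of_mem (Finset.mem_image.2
        ⟨j, Finset.mem_range.2 (Nat.lt_succ_of_le hj), rfl⟩)]
    calc (n : ℝ) ^ γ = T ^ p := by
          rw [hT, ← Real.rpow_mul hn0.le, div_mul_cancel₀ _ hp.ne']
      _ < (localTime (fun k => S k ω) n 0 : ℝ) ^ p := by gcongr
      _ ≤ _ := Finset.single_le_sum (f := fun x => (localTime (fun k => S k ω) n x : ℝ) ^ p)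
        (fun x _ => by positivity) (Finset.mem_insert_self _ _)
  refine le_trans ?_ (hfollow.trans (measureReal_mono hsub))
  have e : (1 / (2 * (d : ℝ))) ^ (2 * k) = Real.exp (-(2 * Real.log (2 * d)) * k) := by
    rw [one_div, inv_pow, ← Real.exp_log (show (0 : ℝ) < 2 * d by linarith), ← Real.exp_nat_mul,
      ← Real.exp_neg, Real.log_exp]
    congr 1
    push_cast
    ring
  rw [e, Real.exp_le_exp, neg_mul, neg_mul, neg_le_neg_iff]
  gcongr

/-- In a box of side at most `n^η` the power mean inequality gives a power sum of at least `(n+1)^p`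
divided by the volume to the power `p - 1`, which exceeds `n^γ`. Confinement costs `n` over the
squared side, and `1 - 2η = ζ`. -/
theorem lower_bound_of_confinement {d : ℕ} (hd : 0 < d) {p γ ζ : ℝ} (hp1 : 1 < p) (hγp : γ < p)
    (hζ : ζ = 1 - (2 / (d : ℝ)) * ((p - γ) / (p - 1))) :
    ∃ c > (0 : ℝ), ∀ᶠ n : ℕ in Filter.atTop,
      ∀ (Ω : Type*) [MeasurableSpace Ω] (μ : Measure Ω) [IsProbabilityMeasure μ]
        (S : ℕ → Ω → (Fin d → ℤ)), IsSimpleRandomWalk μ d S →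
        Real.exp (-c * (n : ℝ) ^ ζ) ≤
          μ.real {ω | (n : ℝ) ^ γ < localTimePowerSum (fun k => S k ω) n p} := by
  have hd0 : (0 : ℝ) < d := by exact_mod_cast hd
  set η : ℝ := (p - γ) / (p - 1) / d with hη
  have hη0 : 0 < η := div_pos (div_pos (by linarith) (by linarith)) hd0
  refine ⟨4 * Real.pi ^ 2, by positivity, ?_⟩
  -- Since `2π < 8`, this forces `θ ≤ 1`, as needed for `cos θ ≥ 1 - θ²/2 ≥ 1/(1 + θ²) ≥ exp(-θ²)`.
  have hev : ∀ᶠ n : ℕ in Filter.atTop, 8 ≤ (n : ℝ) ^ η :=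
    ((tendsto_rpow_atTop hη0).comp tendsto_natCast_atTop_atTop).eventually_ge_atTop _
  filter_upwards [hev, Filter.eventually_ge_atTop 1] with n hn hn1
  intro Ω _ μ _ S hS
  have hn0 : (0 : ℝ) < n := by exact_mod_cast hn1
  set y : ℝ := (n : ℝ) ^ η with hy
  have hy0 : 0 < y := by linarith
  set R : ℕ := ⌊(y - 1) / 2⌋₊ with hR
  have hR1 : (R : ℝ) ≤ (y - 1) / 2 := Nat.floor_le (by linarith)
  have hR2 : (y - 1) / 2 < R + 1 := Nat.lt_floor_add_one _
  set θ : ℝ := Real.pi / (2 * ((R : ℝ) + 1)) with hθ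
  have hπ3 := Real.pi_gt_three
  have hπ4 := Real.pi_lt_four
  have hθy : θ ≤ 2 * Real.pi / y := by
    rw [hθ, div_le_div_iff₀ (by positivity) hy0]
    nlinarith
  have hθ0 : 0 ≤ θ := by positivity
  have hθ1 : θ ≤ 1 := by
    refine hθy.trans ?_
    rw [div_le_one hy0]
    linarith
  have hcos : Real.exp (-θ ^ 2) ≤ Real.cos θ := by
    have h1 := Real.one_sub_sq_div_two_le_cos (x := θ)
    have h2 := Real.add_one_le_exp (θ ^ 2)
    rw [Real.exp_neg, inv_le_comm₀ (Real.exp_pos _) (by nlinarith)]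
    refine le_trans ?_ h2
    rw [inv_le_comm₀ (by nlinarith) (by positivity)]
    refine le_trans ?_ h1
    rw [inv_le_iff_one_le_mul₀ (by positivity)]
    nlinarith [sq_nonneg θ, mul_nonneg (sq_nonneg θ) (sub_nonneg.2 (pow_le_one₀ hθ0 hθ1 (n := 2)))]
  have hsub : {ω | ∀ j ≤ n, ∀ i, |S j ω i| ≤ R} ⊆
      {ω | (n : ℝ) ^ γ < localTimePowerSum (fun k => S k ω) n p} := by
    intro ω hω
    have hω' : ∀ j ≤ n, ∀ i, |S j ω i| ≤ R := hω
    change (n : ℝ) ^ γ < localTimePowerSum (fun k => S k ω) n p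
    set Q : Finset (Fin d → ℤ) := Fintype.piFinset fun _ => Finset.Icc (-(R : ℤ)) R with hQ
    have hQc : Q.card = (2 * R + 1) ^ d := by
      rw [hQ, Fintype.card_piFinset_const, Int.card_Icc]
      congr 1
      omega
    have hmem : ∀ k ≤ n, S k ω ∈ Q := fun k hk => by
      rw [hQ, Fintype.mem_piFinset]
      exact fun i => Finset.mem_Icc.2 (abs_le.1 (hω' k hk i))
    rw [localTimePowerSum_eq_sum (fun k => S k ω) n (by linarith) hmem]
    have hsum : ∑ x ∈ Q, localTime (fun k => S k ω) n x = n + 1 := by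
      rw [sum_localTime, Finset.sum_congr rfl fun k hk =>
        if_pos (hmem k (Nat.lt_succ_iff.1 (Finset.mem_range.1 hk)))]
      simp
    have hpm := Real.rpow_sum_le_const_mul_sum_rpow_of_nonneg Q
      (f := fun x => (localTime (fun k => S k ω) n x : ℝ)) hp1.le fun x _ => Nat.cast_nonneg _
    rw [← Nat.cast_sum, hsum] at hpm
    have hQy : (Q.card : ℝ) ^ (p - 1) ≤ (n : ℝ) ^ (p - γ) := by
      rw [hQc]
      push_cast
      calc (((2 : ℝ) * R + 1) ^ d) ^ (p - 1) ≤ (y ^ d) ^ (p - 1) := by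
            gcongr
            linarith
        _ = (n : ℝ) ^ (p - γ) := by
          rw [← Real.rpow_natCast y d, hy, ← Real.rpow_mul hn0.le, ← Real.rpow_mul hn0.le, hη,
            div_mul_cancel₀ _ hd0.ne', div_mul_cancel₀ _ (by linarith)]
    set Z := ∑ x ∈ Q, (localTime (fun k => S k ω) n x : ℝ) ^ p
    have hZ : 0 ≤ Z := Finset.sum_nonneg fun x _ => by positivity
    have h1 : (n : ℝ) ^ (p - γ) * (n : ℝ) ^ γ < (n : ℝ) ^ (p - γ) * Z := by
      calc (n : ℝ) ^ (p - γ) * (n : ℝ) ^ γ = (n : ℝ) ^ p := by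
            rw [← Real.rpow_add hn0, sub_add_cancel]
        _ < ((n + 1 : ℕ) : ℝ) ^ p := by
          push_cast
          gcongr
          linarith
        _ ≤ (Q.card : ℝ) ^ (p - 1) * Z := hpm
        _ ≤ _ := by gcongr
    exact lt_of_mul_lt_mul_left h1 (by positivity)
  refine le_trans ?_ ((hS.cos_pow_le_measureReal_box hd R n).trans (measureReal_mono hsub))
  calc Real.exp (-(4 * Real.pi ^ 2) * (n : ℝ) ^ ζ) ≤ Real.exp (-θ ^ 2) ^ n := by
        rw [← Real.exp_nat_mul, Real.exp_le_exp, mul_neg, neg_mul, neg_le_neg_iff]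
        have e : (n : ℝ) ^ ζ = n / y ^ 2 := by
          rw [hζ, hy, ← Real.rpow_natCast, ← Real.rpow_mul hn0.le, Real.rpow_sub hn0, Real.rpow_one]
          congr 2
          rw [hη]
          push_cast
          ring
        rw [e]
        calc (n : ℝ) * θ ^ 2 ≤ n * (2 * Real.pi / y) ^ 2 := by gcongr
          _ = _ := by ring
    _ ≤ Real.cos θ ^ n := by gcongr

end IsSimpleRandomWalk

/-! ### Combining the bounds. -/

theorem proposition1p5 (d : ℕ) (hd : 5 ≤ d) (p γ : ℝ) :
    ((d : ℝ) / ((d : ℝ) - 2) < p →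
      1 + max (p - 2) 0 / (((d : ℝ) - 2) * p + 4) < γ → γ < p →
      ∃ c₁ > (0 : ℝ), ∃ c₂ > (0 : ℝ), ∃ N : ℕ,
        ∀ (Ω : Type*) [MeasurableSpace Ω] (μ : Measure Ω) [IsProbabilityMeasure μ]
          (S : ℕ → Ω → (Fin d → ℤ)), IsSimpleRandomWalk μ d S → ∀ n : ℕ, N ≤ n →
          Real.exp (-c₁ * (n : ℝ) ^ (γ / p)) ≤
              μ.real {ω | (n : ℝ) ^ γ < localTimePowerSum (fun k => S k ω) n p} ∧
            μ.real {ω | (n : ℝ) ^ γ < localTimePowerSum (fun k => S k ω) n p} ≤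
              Real.exp (-c₂ * (n : ℝ) ^ (γ / p))) ∧
    (1 < p → p ≤ (d : ℝ) / ((d : ℝ) - 2) → 1 < γ → γ < p →
      ∀ ζ : ℝ, ζ = 1 - (2 / (d : ℝ)) * ((p - γ) / (p - 1)) → ∀ ε > (0 : ℝ),
      ∃ d₁ > (0 : ℝ), ∃ d₂ > (0 : ℝ), ∃ N : ℕ,
        ∀ (Ω : Type*) [MeasurableSpace Ω] (μ : Measure Ω) [IsProbabilityMeasure μ]
          (S : ℕ → Ω → (Fin d → ℤ)), IsSimpleRandomWalk μ d S → ∀ n : ℕ, N ≤ n →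
          Real.exp (-d₁ * (n : ℝ) ^ ζ) ≤
              μ.real {ω | (n : ℝ) ^ γ < localTimePowerSum (fun k => S k ω) n p} ∧
            μ.real {ω | (n : ℝ) ^ γ < localTimePowerSum (fun k => S k ω) n p} ≤
              Real.exp (-d₂ * (n : ℝ) ^ (ζ - ε))) := by
  have hd0 : 0 < d := by omega
  have hd2 : (2 : ℝ) < d := by exact_mod_cast (by omega : 2 < d)
  refine ⟨fun hp hγ hγp => ?_, fun hp1 hp hγ hγp ζ hζ ε hε => ?_⟩
  · have hp1 : 1 < p := lt_trans (by rw [lt_div_iff₀] <;> linarith) hp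
    have hγ1 : 1 < γ := by
      refine lt_of_le_of_lt ?_ hγ
      have h1 : 0 ≤ ((d : ℝ) - 2) * p + 4 := by nlinarith
      have h2 : 0 ≤ max (p - 2) 0 / (((d : ℝ) - 2) * p + 4) := div_nonneg (le_max_right _ _) h1
      linarith
    obtain ⟨c₁, hc₁, h₁⟩ := IsSimpleRandomWalk.lower_bound_of_return (d := d) hd0 (by linarith) hγp
    obtain ⟨c₂, hc₂, h₂⟩ := IsSimpleRandomWalk.exists_upper_bound_of_large_exponent (d := d)
      (by omega) hp hγ1
    obtain ⟨N, hN⟩ := Filter.eventually_atTop.1 (h₁.and h₂)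
    exact ⟨c₁, hc₁, c₂, hc₂, N, fun Ω _ μ _ S hS n hn =>
      ⟨(hN n hn).1 Ω μ S hS, (hN n hn).2 Ω μ S hS⟩⟩
  · obtain ⟨c₁, hc₁, h₁⟩ := IsSimpleRandomWalk.lower_bound_of_confinement (d := d) hd0 hp1 hγp hζ
    obtain ⟨c₂, hc₂, h₂⟩ := IsSimpleRandomWalk.exists_upper_bound_of_small_exponent (d := d)
      (by omega) hp1 hp hγ hγp hζ hε
    obtain ⟨N, hN⟩ := Filter.eventually_atTop.1 (h₁.and h₂)
    exact ⟨c₁, hc₁, c₂, hc₂, N, fun Ω _ μ _ S hS n hn =>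
      ⟨(hN n hn).1 Ω μ S hS, (hN n hn).2 Ω μ S hS⟩⟩
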